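/- **Conventions.** An \emph{$st$-digraph} is a finite acyclic digraph $G=(V,E)$ with exactly one source $s$ and exactly one sink $t$. All drawings are \emph{upward}: vertices are distinct points of the plane, each edge is a curve that increases monotonically in the vertical direction and passes through no vertex other than its end-vertices. An \emph{outerplanar $st$-digraph} is an $st$-digraph embedded by a planar upward drawing in which every vertex lies on the boundary of the external face; this boundary consists of a left and a right side, and $s$ and $t$ belong to both. An \emph{acyclic HP-completion set} of $G$ is a set $P$ of new edges such that $(V,E\cup P)$ is acyclic and has a hamiltonian path from $s$ to $t$ that uses all edges of $P$. It is \emph{crossing-optimal}, with a given upward drawing of $(V,E\cup P)$ that preserves the embedding of $G$, if this drawing has the smallest number of edge crossings among all acyclic HP-completion sets of $G$ and all their upward drawings that preserve the embedding of $G$. An \emph{$st$-polygon} is an outerplanar $st$-digraph whose two sides have only its source and sink in common, each contain at least one further vertex, and are such that no edge joins a vertex of one side to a vertex of the other (source and sink excepted). A \emph{maximal $st$-polygon} of $G$ is an induced embedded subgraph that is an $st$-polygon and is not contained in one with more vertices. An \emph{upper limiting edge} of it is an edge on its external boundary that enters its sink and has its end-vertices on different sides of $G$, where a vertex lying on both sides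 of $G$, such as $t$, counts for either side (there is one such edge, or two if the sink of the polygon lies on both sides of $G$). A vertex in no maximal $st$-polygon is \emph{free}. The \emph{$st$-polygon decomposition} $\mathcal D(G)=\{o_1,\dots,o_\lambda\}$ consists of the maximal $st$-polygons and the free vertices, ordered so that $o_i$ precedes $o_j$ iff $G$ has a directed path from the representative of $o_i$ to that of $o_j$; the representative of a polygon is its source, that of a free vertex is the vertex itself. $G_i$ is the subgraph induced by the vertices of $o_1,\dots,o_i$. **Theorem.** Let $G$ be an outerplanar $st$-digraph and let $\mathcal D(G)=\{o_1,\dots,o_\lambda\}$ be its $st$-polygon decomposition. Then there exists a crossing-optimal acyclic HP-completion set $P_{\mathrm{opt}}$ for $G$ (with an optimal drawing) such that a) each edge of $E$ is crossed by at most two edges of $P_{\mathrm{opt}}$; b) for each maximal $st$-polygon $o_i$, every upper limiting edge $e_i$ of $o_i$ is crossed by at most one edge of $P_{\mathrm{opt}}$; moreover, the edge of $P_{\mathrm{opt}}$ crossing $e_i$, if any, enters $G_i$, that is, it is directed from a vertex outside $G_i$ to a vertex of $G_i$. -/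

import Mathlib

open Set Filter Topology

/-! ## Digraphs -/

/-- The digraph on `V` whose edges are the pairs in `P`. -/
def edgesDigraph {V : Type*} (P : Set (V × V)) : Digraph V := ⟨fun u v => (u, v) ∈ P⟩

/-- The subdigraph of `G` induced by a set of vertices. -/
def inducedDigraph {V : Type*} (G : Digraph V) (S : Set V) : Digraph S :=
  ⟨fun u v => G.Adj u v⟩

/-- No directed cycle (in particular no loop and no pair of opposite edges). -/
def AcyclicDigraph {V : Type*} (G : Digraph V) : Prop := ∀ v, ¬ Relation.TransGen G.Adj v v

/-- There is a directed path (possibly of length zero) from `u` to `v`. -/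
def DirectedPath {V : Type*} (G : Digraph V) (u v : V) : Prop := Relation.ReflTransGen G.Adj u v

/-- An `st`-digraph: acyclic, `s` is the only source and `t` is the only sink. -/
structure IsSTDigraph {V : Type*} (G : Digraph V) (s t : V) : Prop where
  acyclic : AcyclicDigraph G
  source : ∀ v, (∀ u, ¬ G.Adj u v) ↔ v = s
  sink : ∀ v, (∀ u, ¬ G.Adj v u) ↔ v = t

/-- `l` is a hamiltonian path of `G` from `s` to `t`. -/
structure IsHamPath {V : Type*} (G : Digraph V) (s t : V) (l : List V) : Prop where
  chain : l.IsChain G.Adj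
  nodup : l.Nodup
  all : ∀ v, v ∈ l
  first : l.head? = some s
  last : l.getLast? = some t

/-- An acyclic HP-completion set of `G`: a set `P` of new edges such that `G` together with `P`
is acyclic and has a hamiltonian path from `s` to `t` that uses every edge of `P`. -/
structure IsAcyclicHPCompletion {V : Type*} (G : Digraph V) (s t : V) (P : Set (V × V)) :
    Prop where
  new : ∀ u v, (u, v) ∈ P → ¬ G.Adj u v
  acyclic : AcyclicDigraph (G ⊔ edgesDigraph P)
  ham : ∃ l : List V, IsHamPath (G ⊔ edgesDigraph P) s t l ∧
    ∀ u v, (u, v) ∈ P → [u, v] <:+: l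

/-! ## Upward drawings -/

/-- An upward drawing in the plane: vertices are distinct points `(x v, y v)`, and every edge
`(u, v)` is a curve that increases monotonically in the vertical direction, that is, the graph
`h ↦ (curve u v h, h)` of a continuous function of the height `h ∈ [y u, y v]`, from the point of
`u` to the point of `v`, which passes through no other vertex. -/
structure UpwardDrawing {V : Type*} (G : Digraph V) where
  x : V → ℝ
  y : V → ℝ
  curve : V → V → ℝ → ℝ
  distinct : Function.Injective fun v => (x v, y v)
  upward : ∀ u v, G.Adj u v → y u < y v
  cont : ∀ u v, G.Adj u v → ContinuousOn (curve u v) (Icc (y u) (y v))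
  curve_start : ∀ u v, G.Adj u v → curve u v (y u) = x u
  curve_end : ∀ u v, G.Adj u v → curve u v (y v) = x v
  avoids : ∀ u v, G.Adj u v → ∀ w, w ≠ u → w ≠ v → y w ∈ Icc (y u) (y v) →
    curve u v (y w) ≠ x w

namespace UpwardDrawing

variable {V : Type*} {G : Digraph V}

/-- The drawing that remains when edges are deleted. -/
def restrict {H : Digraph V} (D : UpwardDrawing H) (hle : G ≤ H) : UpwardDrawing G where
  x := D.x
  y := D.y
  curve := D.curve
  distinct := D.distinct
  upward u v h := D.upward u v (hle h)
  cont u v h := D.cont u v (hle h)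
  curve_start u v h := D.curve_start u v (hle h)
  curve_end u v h := D.curve_end u v (hle h)
  avoids u v h := D.avoids u v (hle h)

/-- The drawing of the subdigraph induced by a set of vertices. -/
def induce (D : UpwardDrawing G) (S : Set V) : UpwardDrawing (inducedDigraph G S) where
  x v := D.x v
  y v := D.y v
  curve u v := D.curve u v
  distinct _ _ h := Subtype.ext (D.distinct h)
  upward u v h := D.upward u v h
  cont u v h := D.cont u v h
  curve_start u v h := D.curve_start u v h
  curve_end u v h := D.curve_end u v h
  avoids u v h w hu hv hw :=
    D.avoids u v h w (fun e => hu (Subtype.ext e)) (fun e => hv (Subtype.ext e)) hw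

/-- The heights at which the edges `e` and `f` meet at a point other than an end-vertex. -/
def meetHeights (D : UpwardDrawing G) (e f : V × V) : Set ℝ :=
  {h | h ∈ Ioo (D.y e.1) (D.y e.2) ∧ h ∈ Ioo (D.y f.1) (D.y f.2) ∧
    D.curve e.1 e.2 h = D.curve f.1 f.2 h}

/-- The edge `e` crosses the edge `f`. -/
def EdgesCross (D : UpwardDrawing G) (e f : V × V) : Prop := (D.meetHeights e f).Nonempty

/-- The edge crossings of a drawing: an unordered pair of distinct edges together with the height
of a common point. -/
def crossings (D : UpwardDrawing G) : Set (Sym2 (V × V) × ℝ) :=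
  {p | ∃ e f : V × V, G.Adj e.1 e.2 ∧ G.Adj f.1 f.2 ∧ e ≠ f ∧ p.1 = s(e, f) ∧
    p.2 ∈ D.meetHeights e f}

/-- A planar drawing has no edge crossings. -/
def IsPlanar (D : UpwardDrawing G) : Prop := D.crossings = ∅

/-- Of two edges leaving `u`, the edge to `v` starts to the left of the edge to `w`. -/
def OutLeft (D : UpwardDrawing G) (u v w : V) : Prop :=
  ∀ᶠ h in 𝓝[>] (D.y u), D.curve u v h < D.curve u w h

/-- Of two edges entering `w`, the edge from `u` arrives to the left of the edge from `v`. -/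
def InLeft (D : UpwardDrawing G) (u v w : V) : Prop :=
  ∀ᶠ h in 𝓝[<] (D.y w), D.curve u w h < D.curve v w h

/-- Two planar upward drawings of `G` represent the same embedding: at every vertex the outgoing
edges, and likewise the incoming edges, have the same order from left to right. -/
def SameEmbedding (D D' : UpwardDrawing G) : Prop :=
  (∀ u v w, G.Adj u v → G.Adj u w → (D.OutLeft u v w ↔ D'.OutLeft u v w)) ∧
  (∀ u v w, G.Adj u w → G.Adj v w → (D.InLeft u v w ↔ D'.InLeft u v w))

/-- A drawing of a digraph containing `G` preserves the embedded planar digraph given by the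
drawing `D` of `G`: deleting the other edges leaves a planar drawing with the same embedding. -/
def Preserves {H : Digraph V} (D' : UpwardDrawing H) (hle : G ≤ H) (D : UpwardDrawing G) : Prop :=
  (D'.restrict hle).IsPlanar ∧ D.SameEmbedding (D'.restrict hle)

/-- `v` lies on the left part of the boundary of the external face: no edge (hence, in an
`st`-digraph, nothing of the drawing) is to the left of `v` at the height of `v`. -/
def OnLeft (D : UpwardDrawing G) (v : V) : Prop :=
  ∀ a b, G.Adj a b → D.y v ∈ Icc (D.y a) (D.y b) → D.x v ≤ D.curve a b (D.y v)

/-- `v` lies on the right part of the boundary of the external face. -/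
def OnRight (D : UpwardDrawing G) (v : V) : Prop :=
  ∀ a b, G.Adj a b → D.y v ∈ Icc (D.y a) (D.y b) → D.curve a b (D.y v) ≤ D.x v

/-- The edge `(u, v)` lies on the left part of the boundary of the external face. -/
def EdgeOnLeft (D : UpwardDrawing G) (u v : V) : Prop :=
  G.Adj u v ∧ ∀ a b, G.Adj a b → ∀ h ∈ Icc (D.y u) (D.y v), h ∈ Icc (D.y a) (D.y b) →
    D.curve u v h ≤ D.curve a b h

/-- The edge `(u, v)` lies on the right part of the boundary of the external face. -/
def EdgeOnRight (D : UpwardDrawing G) (u v : V) : Prop :=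
  G.Adj u v ∧ ∀ a b, G.Adj a b → ∀ h ∈ Icc (D.y u) (D.y v), h ∈ Icc (D.y a) (D.y b) →
    D.curve a b h ≤ D.curve u v h

/-- The drawing shows an outerplanar `st`-digraph: an `st`-digraph with a planar upward drawing
in which all vertices lie on the boundary of the external face. -/
structure IsOuterplanarST (D : UpwardDrawing G) (s t : V) : Prop where
  st : IsSTDigraph G s t
  planar : D.IsPlanar
  outer : ∀ v, D.OnLeft v ∨ D.OnRight v

/-! ## `st`-polygons and the `st`-polygon decomposition -/

/-- An `st`-polygon (strong if it has the edge `(s, t)`, its median, and weak otherwise): an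
outerplanar `st`-digraph with at least one vertex besides `s` and `t` on each of its two sides,
the two sides having only `s` and `t` in common, and no edge between its two opposite sides.
These are the embedded digraphs in which `(s, t)` either is an edge in the interior of the drawing
or can be added as such an edge. -/
structure IsSTPolygon (D : UpwardDrawing G) (s t : V) : Prop where
  outerplanar : D.IsOuterplanarST s t
  left_vertex : ∃ v, v ≠ s ∧ v ≠ t ∧ D.OnLeft v
  right_vertex : ∃ v, v ≠ s ∧ v ≠ t ∧ D.OnRight v
  sides_disjoint : ∀ v, v ≠ s → v ≠ t → ¬ (D.OnLeft v ∧ D.OnRight v)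
  no_two_sided : ∀ u v, u ≠ s → u ≠ t → v ≠ s → v ≠ t → D.OnLeft u → D.OnRight v →
    ¬ G.Adj u v ∧ ¬ G.Adj v u

/-- The embedded subdigraph induced by the vertex set `S` is an `st`-polygon with source `a` and
sink `d`. -/
def STPolygonOn (D : UpwardDrawing G) (S : Set V) (a d : V) : Prop :=
  ∃ (ha : a ∈ S) (hd : d ∈ S), (D.induce S).IsSTPolygon ⟨a, ha⟩ ⟨d, hd⟩

/-- `S` is the vertex set of a maximal `st`-polygon, with source `a` and sink `d`: it cannot be
extended to an `st`-polygon with more vertices. -/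
def IsMaximalSTPolygon (D : UpwardDrawing G) (S : Set V) (a d : V) : Prop :=
  D.STPolygonOn S a d ∧ ∀ S' a' d', D.STPolygonOn S' a' d' → ¬ S ⊂ S'

/-- A free vertex belongs to no maximal `st`-polygon. -/
def IsFreeVertex (D : UpwardDrawing G) (v : V) : Prop :=
  ∀ S a d, D.IsMaximalSTPolygon S a d → v ∉ S

/-- The elements of the `st`-polygon decomposition, given by their vertex set `o` and their
representative `r`: the maximal `st`-polygons, represented by their sources, and the free
vertices, represented by themselves. -/
def IsDecompositionElement (D : UpwardDrawing G) (o : Set V) (r : V) : Prop :=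
  (∃ d, D.IsMaximalSTPolygon o r d) ∨ (D.IsFreeVertex r ∧ o = {r})

/-- The vertices of the digraph `G_i` for an element `o_i` with representative `r` of the
decomposition: the union of the elements up to and including `o_i`, in the order in which an
element precedes another iff there is a directed path between their representatives. -/
def upToElement (D : UpwardDrawing G) (r : V) : Set V :=
  {v | ∃ o r', D.IsDecompositionElement o r' ∧ DirectedPath G r' r ∧ v ∈ o}

/-- `(x, d)` is the upper limiting edge of the maximal `st`-polygon `S` with sink `d`: an edge of
the external boundary of the polygon that enters its sink and has its end-vertices on different
sides of `G`. (Source and sink of `G` lie on both sides.) -/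
def IsUpperLimitingEdge (D : UpwardDrawing G) (S : Set V) (x d : V) : Prop :=
  (∃ (hx : x ∈ S) (hd : d ∈ S), (D.induce S).EdgeOnLeft ⟨x, hx⟩ ⟨d, hd⟩ ∨
    (D.induce S).EdgeOnRight ⟨x, hx⟩ ⟨d, hd⟩) ∧
  ((D.OnLeft x ∧ D.OnRight d) ∨ (D.OnRight x ∧ D.OnLeft d))

/-! ## Crossing-optimal HP-completion sets -/

/-- `P`, drawn by `D'`, is a crossing-optimal acyclic HP-completion set of the embedded digraph
given by `D`: it has the least number of edge crossings among all acyclic HP-completion sets and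
all their upward drawings that preserve the embedding. -/
structure IsCrossingOptimal (D : UpwardDrawing G) (s t : V) (P : Set (V × V))
    (D' : UpwardDrawing (G ⊔ edgesDigraph P)) : Prop where
  completion : IsAcyclicHPCompletion G s t P
  preserves : D'.Preserves le_sup_left D
  optimal : ∀ (Q : Set (V × V)) (D'' : UpwardDrawing (G ⊔ edgesDigraph Q)),
    IsAcyclicHPCompletion G s t Q → D''.Preserves le_sup_left D →
      D'.crossings.encard ≤ D''.crossings.encard

end UpwardDrawing

/-! ## Directed paths -/

/-! Everything reduces to linear extensions of `G`. In an upward drawing of an acyclic HP-completion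
the heights increase along the hamiltonian path, so this path is a linear extension `σ`. If two
consecutive vertices of `σ` have no side in common (a switch), the edge joining them must cross
every edge of `G` that starts before and ends after the pair, by the intermediate value theorem.
These forced crossings bound the crossing number from below (`exists_linExt_forcedCrossings_le`).
The bound is attained: with the vertices at heights `σ` on the two arcs of a convex lens and
straight edges, the embedding is preserved and only forced crossings occur (`lens_sameEmbedding`,
`encard_lens_crossings_le`).

Take `σ` with fewest forced crossings and, among these, fewest switches. Suppose that a left vertex
is followed by a block of right vertices, a block of left vertices and a right vertex. When no edge
forbids it, exchanging the two blocks loses switches and gains no forced crossing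
(`exists_fewer_switches`). Three switches around one edge would produce this pattern
(`no_three_switches`), which gives (a).

For (b), let the limiting edge go from `x` on the left to `d` on the right. Now `x` and `d`
themselves can bound the pattern, so no switch around the edge goes from right to left
(`no_switch_down`). Between two switches from left to right there is one from right to left, so at
most one switch remains. It leads from a left vertex after `x` to a right vertex before `d`. Maximal
polygons are the path intervals of maximal polygon pairs (`isMaximalSTPolygon_iff`), so membership
in `G_i` is a question about directed paths: the tail is excluded by maximality of the polygon
(`not_mem_lower_polygon`), the head lies in a polygon whose source is an ancestor of that of `o_i`
(`exists_lower_polygon`).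

Planarity enters the order arguments only through `TwoSided`, which is symmetric in the two sides.
-/

theorem DirectedPath.refl {V : Type*} (G : Digraph V) (v : V) : DirectedPath G v v :=
  Relation.ReflTransGen.refl

theorem DirectedPath.single {V : Type*} {G : Digraph V} {u v : V} (h : G.Adj u v) :
    DirectedPath G u v := Relation.ReflTransGen.single h

theorem DirectedPath.trans {V : Type*} {G : Digraph V} {u v w : V} (h : DirectedPath G u v)
    (h' : DirectedPath G v w) : DirectedPath G u w := Relation.ReflTransGen.trans h h'

theorem DirectedPath.exists_head {V : Type*} {G : Digraph V} {u v : V} (h : DirectedPath G u v)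
    (hne : u ≠ v) : ∃ w, G.Adj u w ∧ DirectedPath G w v := by
  rcases Relation.ReflTransGen.cases_head h with h | h
  · exact absurd h hne
  · exact h

theorem DirectedPath.exists_tail {V : Type*} {G : Digraph V} {u v : V} (h : DirectedPath G u v)
    (hne : u ≠ v) : ∃ w, DirectedPath G u w ∧ G.Adj w v := by
  rcases Relation.ReflTransGen.cases_tail h with h | h
  · exact absurd h.symm hne
  · exact h

theorem AcyclicDigraph.antisymm {V : Type*} {G : Digraph V} (hG : AcyclicDigraph G) {u v : V}
    (h : DirectedPath G u v) (h' : DirectedPath G v u) : u = v := by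
  rcases Relation.reflTransGen_iff_eq_or_transGen.1 h with h | h
  · exact h.symm
  · exact absurd (Relation.TransGen.trans_left h h') (hG u)

theorem AcyclicDigraph.ne_of_adj {V : Type*} {G : Digraph V} (hG : AcyclicDigraph G) {u v : V}
    (h : G.Adj u v) : u ≠ v := by
  rintro rfl
  exact hG u (Relation.TransGen.single h)

theorem AcyclicDigraph.not_adj_of_path {V : Type*} {G : Digraph V} (hG : AcyclicDigraph G)
    {u v : V} (h : DirectedPath G u v) : ¬ G.Adj v u := fun h' =>
  hG u (Relation.TransGen.trans_right h (Relation.TransGen.single h'))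

/-! ## Linear extensions -/

/-- A numbering of the vertices by `0, …, n - 1` along which all edges increase. -/
structure LinExt {V : Type*} (G : Digraph V) (σ : V → ℕ) : Prop where
  inj : Function.Injective σ
  mono : ∀ u v, G.Adj u v → σ u < σ v
  lt : ∀ v, σ v < Nat.card V

namespace LinExt

variable {V : Type*} {G : Digraph V} {σ : V → ℕ}

theorem le (hσ : LinExt G σ) {u v : V} (h : DirectedPath G u v) : σ u ≤ σ v := by
  induction h with
  | refl => exact le_rfl
  | tail _ h ih => exact ih.trans (hσ.mono _ _ h).le

theorem lt_of_ne (hσ : LinExt G σ) {u v : V} (h : DirectedPath G u v) (hne : u ≠ v) :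
    σ u < σ v := lt_of_le_of_ne (hσ.le h) fun e => hne (hσ.inj e)

theorem ne (_ : LinExt G σ) {u v : V} (h : σ u < σ v) : u ≠ v := fun e => by simp [e] at h

theorem not_path (hσ : LinExt G σ) {u v : V} (h : σ u < σ v) : ¬ DirectedPath G v u :=
  fun h' => (hσ.le h').not_gt h

theorem exists_eq [Finite V] (hσ : LinExt G σ) {i : ℕ} (hi : i < Nat.card V) : ∃ v, σ v = i := by
  have hinj : Function.Injective fun v => (⟨σ v, hσ.lt v⟩ : Fin (Nat.card V)) := fun u v h =>
    hσ.inj (Fin.mk.inj_iff.1 h)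
  have := Fintype.ofFinite V
  have hb := (Fintype.bijective_iff_injective_and_card _).2 ⟨hinj, by simp⟩
  obtain ⟨v, hv⟩ := hb.2 ⟨i, hi⟩
  exact ⟨v, Fin.mk.inj_iff.1 hv⟩

end LinExt

/-! ## Two-sided digraphs -/

/-- The tail `a` of an edge is to the left of the tail `c` of an overlapping edge. -/
def TailLeft {V : Type*} (G : Digraph V) (L R : V → Prop) (a c : V) : Prop :=
  -- Of two comparable tails the higher one decides: a left vertex has the other edge to its right,
  -- a right vertex has it to its left. On opposite sides no comparison is needed.
  a ≠ c ∧ ((L a ∧ DirectedPath G c a) ∨ (R c ∧ DirectedPath G a c) ∨ (L a ∧ R c))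

/-- The head `b` of an edge is to the left of the head `d` of an overlapping edge. -/
def HeadLeft {V : Type*} (G : Digraph V) (L R : V → Prop) (b d : V) : Prop :=
  b ≠ d ∧ ((L b ∧ DirectedPath G b d) ∨ (R d ∧ DirectedPath G d b) ∨ (L b ∧ R d))

/-- The combinatorial content of an outerplanar embedding with left side `L` and right
side `R`. -/
structure TwoSided {V : Type*} (G : Digraph V) (L R : V → Prop) : Prop where
  acyclic : AcyclicDigraph G
  cover : ∀ v, L v ∨ R v
  chain_left : ∀ u v, L u → L v → DirectedPath G u v ∨ DirectedPath G v u
  chain_right : ∀ u v, R u → R v → DirectedPath G u v ∨ DirectedPath G v u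
  not_spanned : ∀ a b v, G.Adj a b → DirectedPath G a v → DirectedPath G v b → v ≠ a → v ≠ b →
    L v → R v → False
  -- The edge `(a, b)` starts to the left of `(c, d)` and ends to its right. The two negated paths
  -- express that neither edge lies wholly below the other.
  noncrossing : ∀ a b c d, G.Adj a b → G.Adj c d → TailLeft G L R a c → HeadLeft G L R d b →
    ¬ DirectedPath G b c → ¬ DirectedPath G d a → False

theorem TailLeft.symm {V : Type*} {G : Digraph V} {L R : V → Prop} {a c : V}
    (h : TailLeft G L R a c) : TailLeft G R L c a := by
  obtain ⟨h, h'⟩ := h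
  exact ⟨h.symm, by tauto⟩

theorem HeadLeft.symm {V : Type*} {G : Digraph V} {L R : V → Prop} {a c : V}
    (h : HeadLeft G L R a c) : HeadLeft G R L c a := by
  obtain ⟨h, h'⟩ := h
  exact ⟨h.symm, by tauto⟩

namespace TwoSided

variable {V : Type*} {G : Digraph V} {L R : V → Prop} {σ : V → ℕ}

theorem symm (h : TwoSided G L R) : TwoSided G R L where
  acyclic := h.acyclic
  cover v := (h.cover v).symm
  chain_left := h.chain_right
  chain_right := h.chain_left
  not_spanned a b v h1 h2 h3 h4 h5 h6 h7 := h.not_spanned a b v h1 h2 h3 h4 h5 h7 h6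
  noncrossing a b c d h1 h2 h3 h4 h5 h6 :=
    h.noncrossing c d a b h2 h1 h3.symm h4.symm h6 h5

theorem tailLeft_total (h : TwoSided G L R) {a c : V} (hne : a ≠ c) :
    TailLeft G L R a c ∨ TailLeft G L R c a := by
  have h1 := h.cover a
  have h2 := h.cover c
  have h3 := h.chain_left a c
  have h4 := h.chain_right a c
  unfold TailLeft
  have := hne.symm
  tauto

theorem headLeft_total (h : TwoSided G L R) {a c : V} (hne : a ≠ c) :
    HeadLeft G L R a c ∨ HeadLeft G L R c a := by
  have h1 := h.cover a
  have h2 := h.cover c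
  have h3 := h.chain_left a c
  have h4 := h.chain_right a c
  unfold HeadLeft
  have := hne.symm
  tauto

theorem path_of_left (h : TwoSided G L R) (hσ : LinExt G σ) {u v : V} (hu : L u) (hv : L v)
    (huv : σ u ≤ σ v) : DirectedPath G u v := by
  rcases h.chain_left u v hu hv with h | h
  · exact h
  · rw [hσ.inj (le_antisymm huv (hσ.le h))]; exact .refl G v

theorem path_of_right (h : TwoSided G L R) (hσ : LinExt G σ) {u v : V} (hu : R u) (hv : R v)
    (huv : σ u ≤ σ v) : DirectedPath G u v := h.symm.path_of_left hσ hu hv huv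

theorem tailLeft_of_left (h : TwoSided G L R) (hσ : LinExt G σ) {a u : V} (hu : L u)
    (hau : σ a < σ u) : TailLeft G L R u a := by
  refine ⟨(hσ.ne hau).symm, ?_⟩
  rcases h.cover a with ha | ha
  · exact .inl ⟨hu, h.path_of_left hσ ha hu hau.le⟩
  · exact .inr (.inr ⟨hu, ha⟩)

theorem headLeft_of_left (h : TwoSided G L R) (hσ : LinExt G σ) {b u : V} (hu : L u)
    (hub : σ u < σ b) : HeadLeft G L R u b := by
  refine ⟨hσ.ne hub, ?_⟩
  rcases h.cover b with hb | hb
  · exact .inl ⟨hu, h.path_of_left hσ hu hb hub.le⟩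
  · exact .inr (.inr ⟨hu, hb⟩)

theorem tailLeft_of_right (h : TwoSided G L R) (hσ : LinExt G σ) {a u : V} (hu : R u)
    (hau : σ a < σ u) : TailLeft G L R a u := (h.symm.tailLeft_of_left hσ hu hau).symm

theorem headLeft_of_right (h : TwoSided G L R) (hσ : LinExt G σ) {b u : V} (hu : R u)
    (hub : σ u < σ b) : HeadLeft G L R b u := (h.symm.headLeft_of_left hσ hu hub).symm

/-- There are no edges between the left and the right vertices which a linear extension puts
between the end-vertices of an edge. -/
theorem not_adj_inside (h : TwoSided G L R) (hσ : LinExt G σ) {a b u w : V} (hab : G.Adj a b)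
    (hu : L u) (hw : R w) (hau : σ a < σ u) (hub : σ u < σ b) (haw : σ a < σ w)
    (hwb : σ w < σ b) : ¬ G.Adj u w ∧ ¬ G.Adj w u :=
  ⟨fun hadj => h.noncrossing u w a b hadj hab (h.tailLeft_of_left hσ hu hau)
    (h.headLeft_of_right hσ hw hwb) (hσ.not_path haw) (hσ.not_path hub),
  fun hadj => h.noncrossing a b w u hab hadj (h.tailLeft_of_right hσ hw haw)
    (h.headLeft_of_left hσ hu hub) (hσ.not_path hwb) (hσ.not_path hau)⟩

/-- A vertex on both sides is comparable with every vertex, so lying between `a` and `b` in `σ`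
means lying on a path from `a` to `b`. -/
theorem not_both_inside (h : TwoSided G L R) (hσ : LinExt G σ) {a b v : V} (hab : G.Adj a b)
    (hav : σ a < σ v) (hvb : σ v < σ b) (hL : L v) (hR : R v) : False := by
  refine h.not_spanned a b v hab ?_ ?_ (hσ.ne hav).symm (hσ.ne hvb) hL hR
  · rcases h.cover a with ha | ha
    · exact h.path_of_left hσ ha hL hav.le
    · exact h.path_of_right hσ ha hR hav.le
  · rcases h.cover b with ha | ha
    · exact h.path_of_left hσ hL ha hvb.le
    · exact h.path_of_right hσ hR ha hvb.le

end TwoSided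

/-! ## Switches between the sides -/

/-- The two vertices have no side in common. -/
def SideSwitch {V : Type*} (L R : V → Prop) (u v : V) : Prop := ¬ (L u ∧ L v) ∧ ¬ (R u ∧ R v)

/-- The consecutive vertices of a linear extension which have no side in common. -/
def switchPairs {V : Type*} (L R : V → Prop) (σ : V → ℕ) : Set (V × V) :=
  {p | σ p.2 = σ p.1 + 1 ∧ SideSwitch L R p.1 p.2}

/-- The pairs of a switch and an edge around it. -/
def forcedCrossings {V : Type*} (G : Digraph V) (L R : V → Prop) (σ : V → ℕ) :
    Set ((V × V) × (V × V)) :=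
  {c | c.1 ∈ switchPairs L R σ ∧ G.Adj c.2.1 c.2.2 ∧ σ c.2.1 < σ c.1.1 ∧ σ c.1.2 < σ c.2.2}

theorem SideSwitch.symm {V : Type*} {L R : V → Prop} {u v : V} (h : SideSwitch L R u v) :
    SideSwitch R L u v := ⟨h.2, h.1⟩

theorem switchPairs_symm {V : Type*} (L R : V → Prop) (σ : V → ℕ) :
    switchPairs R L σ = switchPairs L R σ := by
  ext p
  exact ⟨fun h => ⟨h.1, h.2.symm⟩, fun h => ⟨h.1, h.2.symm⟩⟩

theorem forcedCrossings_symm {V : Type*} (G : Digraph V) (L R : V → Prop) (σ : V → ℕ) :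
    forcedCrossings G R L σ = forcedCrossings G L R σ := by
  unfold forcedCrossings
  rw [switchPairs_symm]

/-- The permutation of positions that exchanges the blocks `(i, j]` and `(j, k]`. -/
def blockSwap (i j k n : ℕ) : ℕ :=
  if i < n ∧ n ≤ j then n + (k - j) else if j < n ∧ n ≤ k then n - (j - i) else n

/-- New adjacencies arise only at the three borders of the rearranged order `i`, `(j, k]`, `(i, j]`,
`k + 1`. -/
theorem blockSwap_succ {i j k m n : ℕ} (hij : i < j) (hjk : j < k)
    (h : blockSwap i j k n = blockSwap i j k m + 1) :
    (n = m + 1 ∧ m ≠ i ∧ m ≠ j ∧ m ≠ k) ∨ (m = i ∧ n = j + 1) ∨ (m = k ∧ n = i + 1) ∨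
      (m = j ∧ n = k + 1) := by
  unfold blockSwap at h
  split_ifs at h <;> omega

/-- The order `p B C q` becomes `p C B q`, where `B` and `q` are on the right, `p` and `C` on the
left. The only switch at the borders is now the one from `C` to `B`; it replaces the switches from
`p` to `B` and from `B` to `C`, and the one from `C` to `q` if that was a switch. Each edge around
the new switch was around one of these, since no edge runs from `p` into `B` or from `C` to `q`. -/
theorem TwoSided.exists_fewer_switches {V : Type*} [Finite V] {G : Digraph V} {L R : V → Prop}
    {σ : V → ℕ} (h : TwoSided G L R) (hσ : LinExt G σ) {i j k : ℕ} (hij : i < j) (hjk : j < k)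
    {p q : V} (hp : σ p = i) (hq : σ q = k + 1) (hpL : L p) (hpR : ¬ R p) (hqR : R q)
    (hB : ∀ v, i < σ v → σ v ≤ j → R v ∧ ¬ L v) (hC : ∀ v, j < σ v → σ v ≤ k → L v ∧ ¬ R v)
    (hBC : ∀ u v, i < σ u → σ u ≤ j → j < σ v → σ v ≤ k → ¬ G.Adj u v)
    (hpB : ∀ v, i < σ v → σ v ≤ j → ¬ G.Adj p v)
    (hCq : ∀ v, j < σ v → σ v ≤ k → ¬ G.Adj v q) :
    ∃ τ, LinExt G τ ∧ (forcedCrossings G L R τ).ncard ≤ (forcedCrossings G L R σ).ncard ∧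
      (switchPairs L R τ).ncard < (switchPairs L R σ).ncard := by
  have hkn : k + 1 < Nat.card V := hq ▸ hσ.lt q
  obtain ⟨b₁, hb₁⟩ := hσ.exists_eq (show i + 1 < Nat.card V by omega)
  obtain ⟨b₂, hb₂⟩ := hσ.exists_eq (show j < Nat.card V by omega)
  obtain ⟨c₁, hc₁⟩ := hσ.exists_eq (show j + 1 < Nat.card V by omega)
  obtain ⟨c₂, hc₂⟩ := hσ.exists_eq (show k < Nat.card V by omega)
  have hB₁ := hB b₁ (by omega) (by omega)
  have hB₂ := hB b₂ (by omega) (by omega)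
  have hC₁ := hC c₁ (by omega) (by omega)
  have hC₂ := hC c₂ (by omega) (by omega)
  -- Only an edge from the first block to the second would be reversed.
  have hlin : LinExt G fun v => blockSwap i j k (σ v) := by
    refine ⟨fun u v huv => hσ.inj ?_, fun u v huv => ?_, fun v => ?_⟩
    · simp only [blockSwap] at huv
      split_ifs at huv <;> omega
    · have h1 := hσ.mono u v huv
      have h2 := fun h1 h2 h3 h4 => hBC u v h1 h2 h3 h4 huv
      simp only [blockSwap]
      split_ifs <;> first | omega | (exfalso; exact h2 (by omega) (by omega) (by omega) (by omega))
    · have := hσ.lt v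
      simp only [blockSwap]
      split_ifs <;> omega
  -- a switch of the new order is the new one or an old one outside the two blocks
  have hsw : ∀ u v, (u, v) ∈ switchPairs L R (fun v => blockSwap i j k (σ v)) →
      (u = c₂ ∧ v = b₁) ∨ ((u, v) ∈ switchPairs L R σ ∧ (σ v ≤ i ∨ k < σ u)) := by
    rintro u v ⟨h1, h2⟩
    rcases blockSwap_succ hij hjk h1 with ⟨h3, h4, h5, h6⟩ | ⟨h3, h4⟩ | ⟨h3, h4⟩ | ⟨h3, h4⟩
    · refine .inr ⟨⟨h3, h2⟩, ?_⟩
      simp only at h3 h4 h5 h6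
      by_contra hcon
      by_cases h7 : σ u ≤ j
      · exact h2.2 ⟨(hB u (by omega) (by omega)).1, (hB v (by omega) (by omega)).1⟩
      · exact h2.1 ⟨(hC u (by omega) (by omega)).1, (hC v (by omega) (by omega)).1⟩
    · rw [hσ.inj (h3.trans hp.symm), hσ.inj (h4.trans hc₁.symm)] at h2
      exact absurd ⟨hpL, hC₁.1⟩ h2.1
    · exact .inl ⟨hσ.inj (h3.trans hc₂.symm), hσ.inj (h4.trans hb₁.symm)⟩
    · rw [hσ.inj (h3.trans hb₂.symm), hσ.inj (h4.trans hq.symm)] at h2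
      exact absurd ⟨hB₂.1, hqR⟩ h2.2
  have hold₁ : (p, b₁) ∈ switchPairs L R σ :=
    ⟨by simp only; omega, fun hh => hB₁.2 hh.2, fun hh => hpR hh.1⟩
  have hold₂ : (b₂, c₁) ∈ switchPairs L R σ :=
    ⟨by simp only; omega, fun hh => hB₂.2 hh.1, fun hh => hC₁.2 hh.2⟩
  have hold₃ : ¬ L q → (c₂, q) ∈ switchPairs L R σ := fun hL =>
    ⟨by simp only; omega, fun hh => hL hh.2, fun hh => hC₂.2 hh.1⟩
  classical
  refine ⟨_, hlin, ?_, ?_⟩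
  · -- every edge around the new switch is around one of the three old ones
    have hnew : ∀ e : V × V, ((c₂, b₁), e) ∈ forcedCrossings G L R
        (fun v => blockSwap i j k (σ v)) → ∃ r : V × V, (r, e) ∈ forcedCrossings G L R σ ∧
          i ≤ σ r.1 ∧ σ r.1 ≤ k := by
      rintro ⟨e₁, e₂⟩ ⟨-, hadj, h1, h2⟩
      simp only at hadj h1 h2
      have hlt := hσ.mono _ _ hadj
      have h3 : σ e₁ ≤ i ∨ (j < σ e₁ ∧ σ e₁ < k) := by
        simp only [blockSwap] at h1
        split_ifs at h1 <;> omega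
      have h4 : k + 1 ≤ σ e₂ ∨ (i + 1 < σ e₂ ∧ σ e₂ ≤ j) := by
        simp only [blockSwap] at h2
        split_ifs at h2 <;> omega
      by_cases h5 : σ e₁ < i
      · exact ⟨(p, b₁), ⟨hold₁, hadj, by simp only; omega, by simp only; omega⟩, by
          simp only; omega, by simp only; omega⟩
      by_cases h6 : σ e₁ = i
      · rcases h4 with h4 | h4
        · exact ⟨(b₂, c₁), ⟨hold₂, hadj, by simp only; omega, by simp only; omega⟩, by
            simp only; omega, by simp only; omega⟩
        · rw [hσ.inj (h6.trans hp.symm)] at hadj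
          exact absurd hadj (hpB e₂ (by omega) h4.2)
      by_cases h7 : σ e₂ = k + 1
      · rw [hσ.inj (h7.trans hq.symm)] at hadj
        exact absurd hadj (hCq e₁ (by omega) (by omega))
      · exact ⟨(c₂, q), ⟨hold₃ fun hqL => h.not_both_inside hσ hadj (by omega) (by omega) hqL hqR,
          hadj, by simp only; omega, by simp only; omega⟩, by simp only; omega, by simp only; omega⟩
    choose! g hg using hnew
    -- Crossings of the new switch are charged to old switches starting at a position in `[i, k]`.
    -- Surviving switches start outside this range and are charged to themselves, so the charging is
    -- injective.
    refine Set.ncard_le_ncard_of_injOn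
      (fun c => if c.1 = (c₂, b₁) then (g c.2, c.2) else c) ?_ ?_ (Set.toFinite _)
    · rintro ⟨⟨u, v⟩, e⟩ hc
      by_cases hcc : (u, v) = (c₂, b₁)
      · simp only [hcc, if_true]
        exact (hg e (hcc ▸ hc)).1
      · simp only [hcc, if_false]
        obtain ⟨h1, h2, h3, h4⟩ := hc
        rcases hsw u v h1 with ⟨rfl, rfl⟩ | ⟨h5, h6⟩
        · exact absurd rfl hcc
        · have hs := h5.1
          refine ⟨h5, h2, ?_, ?_⟩
          · simp only [blockSwap] at h3 hs ⊢
            split_ifs at h3 <;> omega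
          · simp only [blockSwap] at h4 hs ⊢
            split_ifs at h4 <;> omega
    · have key : ∀ (u v : V) e e', ((u, v), e) ∈ forcedCrossings G L R
          (fun v => blockSwap i j k (σ v)) → (u, v) ≠ (c₂, b₁) →
          ((c₂, b₁), e') ∈ forcedCrossings G L R (fun v => blockSwap i j k (σ v)) →
          (g e', e') ≠ ((u, v), e) := by
        intro u v e e' h1 h2 h3 h4
        have h5 := hg e' h3
        have h6 : g e' = (u, v) := congrArg Prod.fst h4
        rcases hsw u v h1.1 with ⟨rfl, rfl⟩ | ⟨h7, h8⟩
        · exact h2 rfl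
        · have := h7.1
          rw [h6] at h5
          simp only at h5 this
          omega
      rintro ⟨⟨u, v⟩, e⟩ hc ⟨⟨u', v'⟩, e'⟩ hc' heq
      by_cases h1 : (u, v) = (c₂, b₁) <;> by_cases h2 : (u', v') = (c₂, b₁)
      · simp only [h1, h2, if_true, Prod.mk.injEq] at heq ⊢
        exact ⟨trivial, heq.2⟩
      · simp only [h1, h2, if_true, if_false] at heq
        exact absurd heq (key u' v' e' e hc' h2 (h1 ▸ hc))
      · simp only [h1, h2, if_true, if_false] at heq
        exact absurd heq.symm (key u v e e' hc h1 (h2 ▸ hc'))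
      · simpa only [h1, h2, if_false] using heq
  -- Two old switches vanish for one new one; `(c₂, q)` is not needed for the count.
  · have hsub : switchPairs L R (fun v => blockSwap i j k (σ v)) ⊆
        insert (c₂, b₁) (switchPairs L R σ \ {(p, b₁), (b₂, c₁)}) := by
      rintro ⟨u, v⟩ huv
      rcases hsw u v huv with ⟨rfl, rfl⟩ | ⟨h1, h2⟩
      · exact .inl rfl
      · refine .inr ⟨h1, ?_⟩
        have hs := h1.1
        simp only at hs
        rintro (h3 | h3) <;> obtain ⟨rfl, rfl⟩ := Prod.mk.inj h3 <;> omega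
    have h1 := Set.ncard_le_ncard hsub (Set.toFinite _)
    have h2 := Set.ncard_insert_le (c₂, b₁) (switchPairs L R σ \ {(p, b₁), (b₂, c₁)})
    have hpair : ({(p, b₁), (b₂, c₁)} : Set (V × V)) ⊆ switchPairs L R σ := by
      rintro x (rfl | rfl)
      exacts [hold₁, hold₂]
    have h3 := Set.ncard_sdiff_add_ncard_of_subset hpair (Set.toFinite _)
    have h4 : ({(p, b₁), (b₂, c₁)} : Set (V × V)).ncard = 2 := by
      refine Set.ncard_pair fun e => ?_
      have := (Prod.mk.inj e).1
      rw [this] at hp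
      omega
    omega

/-! ## Optimal linear extensions -/

/-- A linear extension with the least number of forced crossings and, among these, the least number
of switches. -/
structure OptimalLinExt {V : Type*} (G : Digraph V) (L R : V → Prop) (σ : V → ℕ) : Prop where
  linExt : LinExt G σ
  crossings_le : ∀ τ, LinExt G τ →
    (forcedCrossings G L R σ).ncard ≤ (forcedCrossings G L R τ).ncard
  switches_le : ∀ τ, LinExt G τ →
    (forcedCrossings G L R τ).ncard ≤ (forcedCrossings G L R σ).ncard →
    (switchPairs L R σ).ncard ≤ (switchPairs L R τ).ncard

theorem OptimalLinExt.symm {V : Type*} {G : Digraph V} {L R : V → Prop} {σ : V → ℕ}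
    (h : OptimalLinExt G L R σ) : OptimalLinExt G R L σ where
  linExt := h.linExt
  crossings_le := by simpa only [forcedCrossings_symm] using h.crossings_le
  switches_le := by simpa only [forcedCrossings_symm, switchPairs_symm] using h.switches_le

theorem exists_optimalLinExt {V : Type*} {G : Digraph V} (L R : V → Prop) {τ : V → ℕ}
    (hτ : LinExt G τ) : ∃ σ, OptimalLinExt G L R σ := by
  obtain ⟨ρ, hρ, hρmin⟩ := WellFounded.has_min
    (InvImage.wf (fun σ => (forcedCrossings G L R σ).ncard) Nat.lt_wfRel.wf) {σ | LinExt G σ}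
    ⟨τ, hτ⟩
  obtain ⟨σ, ⟨hσ, hσρ⟩, hσmin⟩ := WellFounded.has_min
    (InvImage.wf (fun σ => (switchPairs L R σ).ncard) Nat.lt_wfRel.wf)
    {σ | LinExt G σ ∧ (forcedCrossings G L R σ).ncard ≤ (forcedCrossings G L R ρ).ncard}
    ⟨ρ, hρ, le_rfl⟩
  exact ⟨σ, hσ, fun ν hν => hσρ.trans (not_lt.1 (hρmin ν hν)),
    fun ν hν hle => not_lt.1 (hσmin ν ⟨hν, hle.trans hσρ⟩)⟩

section

variable {V : Type*} [Finite V] {G : Digraph V} {L R : V → Prop} {σ : V → ℕ}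

/-- In an optimal linear extension, no switch from right to left around which there is an edge is
preceded by a left vertex and followed by a right one, up to the ends of the edge. -/
theorem TwoSided.no_zigzag (h : TwoSided G L R) (ho : OptimalLinExt G L R σ) {a b u v p q : V}
    (hab : G.Adj a b) (huv : σ v = σ u + 1) (hau : σ a < σ u) (hvb : σ v < σ b) (hu : R u)
    (hv : L v) (hp : L p) (hpR : ¬ R p) (hap : σ a ≤ σ p) (hpu : σ p < σ u)
    (hpa : σ p = σ a → ∀ r, R r → σ a < σ r → σ r < σ b → ¬ G.Adj a r)
    (hq : R q) (hvq : σ v < σ q) (hqb : σ q ≤ σ b)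
    (hqa : σ q = σ b → ∀ l, L l → σ a < σ l → σ l < σ b → ¬ G.Adj l b) : False := by
  have hσ := ho.linExt
  classical
  -- The nearest left vertex before the switch and the nearest right vertex after it bound the
  -- blocks to be exchanged; this choice makes both blocks one-sided.
  obtain ⟨p', hp', hmax⟩ := Set.exists_max_image {w | L w ∧ σ w < σ u} σ (Set.toFinite _)
    ⟨p, hp, hpu⟩
  obtain ⟨q', hq', hmin⟩ := Set.exists_min_image {w | R w ∧ σ v < σ w} σ (Set.toFinite _)
    ⟨q, hq, hvq⟩
  have hpp' := hmax p ⟨hp, hpu⟩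
  have hqq' := hmin q ⟨hq, hvq⟩
  obtain ⟨hp'L, hp'u⟩ := hp'
  obtain ⟨hq'R, hvq'⟩ := hq'
  have hB : ∀ w, σ p' < σ w → σ w ≤ σ u → R w ∧ ¬ L w := by
    intro w h1 h2
    have : ¬ L w := fun hw => by
      by_cases h3 : σ w < σ u
      · have := hmax w ⟨hw, h3⟩; omega
      · exact h.not_both_inside hσ hab hau (by omega) (hσ.inj (show σ w = σ u by omega) ▸ hw) hu
    exact ⟨(h.cover w).resolve_left this, this⟩
  have hC : ∀ w, σ u < σ w → σ w ≤ σ q' - 1 → L w ∧ ¬ R w := by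
    intro w h1 h2
    have : ¬ R w := fun hw => by
      by_cases h3 : σ v < σ w
      · have := hmin w ⟨hw, h3⟩; omega
      · exact h.not_both_inside hσ hab (by omega) hvb hv (hσ.inj (show σ w = σ v by omega) ▸ hw)
    exact ⟨(h.cover w).resolve_right this, this⟩
  have hp'R : ¬ R p' := fun hR => by
    by_cases h1 : σ p' = σ p
    · exact hpR (hσ.inj h1 ▸ hR)
    · exact h.not_both_inside hσ hab (by omega) (by omega) hp'L hR
  have hBC : ∀ x y, σ p' < σ x → σ x ≤ σ u → σ u < σ y → σ y ≤ σ q' - 1 → ¬ G.Adj x y :=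
    fun x y h1 h2 h3 h4 => (h.not_adj_inside hσ hab (hC y h3 h4).1 (hB x h1 h2).1 (by omega)
      (by omega) (by omega) (by omega)).2
  -- Strictly inside `(a, b)` noncrossing suffices; `hpa` is needed only if `p'` is `a` itself.
  -- Dually for `q'` and `b`.
  have hpB : ∀ x, σ p' < σ x → σ x ≤ σ u → ¬ G.Adj p' x := by
    intro x h1 h2
    by_cases h3 : σ p' = σ a
    · rw [hσ.inj h3]
      exact hpa (by omega) x (hB x h1 h2).1 (by omega) (by omega)
    · exact (h.not_adj_inside hσ hab hp'L (hB x h1 h2).1 (by omega) (by omega) (by omega)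
        (by omega)).1
  have hCq : ∀ x, σ u < σ x → σ x ≤ σ q' - 1 → ¬ G.Adj x q' := by
    intro x h1 h2
    by_cases h3 : σ q' = σ b
    · rw [hσ.inj h3]
      exact hqa (by omega) x (hC x h1 h2).1 (by omega) (by omega)
    · exact (h.not_adj_inside hσ hab (hC x h1 h2).1 hq'R (by omega) (by omega) (by omega)
        (by omega)).1
  obtain ⟨τ, hτ, hcr, hsw⟩ := h.exists_fewer_switches hσ hp'u
    (show σ u < σ q' - 1 by omega) rfl (by omega) hp'L hp'R hq'R hB hC hBC hpB hCq
  exact (ho.switches_le τ hτ hcr).not_gt hsw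

theorem SideSwitch.cases {V : Type*} {G : Digraph V} {L R : V → Prop} (h : TwoSided G L R)
    {u v : V} (hs : SideSwitch L R u v) : (L u ∧ R v) ∨ (R u ∧ L v) := by
  have h1 := h.cover u
  have h2 := h.cover v
  unfold SideSwitch at hs
  tauto

/-- The switches around an edge. -/
def switchesAround {V : Type*} (L R : V → Prop) (σ : V → ℕ) (a b : V) : Set (V × V) :=
  {p | p ∈ switchPairs L R σ ∧ σ a < σ p.1 ∧ σ p.2 < σ b}

/-- The outer switches each have an end on either side. They supply the bounding vertices `p` and
`q` of `no_zigzag` for the middle switch, after a reflection if that one goes from left to right. -/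
theorem TwoSided.no_three_switches (h : TwoSided G L R) (ho : OptimalLinExt G L R σ) {a b : V}
    (hab : G.Adj a b) {p q r : V × V} (hp : p ∈ switchesAround L R σ a b)
    (hq : q ∈ switchesAround L R σ a b) (hr : r ∈ switchesAround L R σ a b)
    (hpq : σ p.1 < σ q.1) (hqr : σ q.1 < σ r.1) : False := by
  have key : ∀ {L R : V → Prop}, TwoSided G L R → OptimalLinExt G L R σ →
      p ∈ switchesAround L R σ a b → q ∈ switchesAround L R σ a b →
      r ∈ switchesAround L R σ a b → R q.1 → L q.2 → False := by
    rintro L R h ho ⟨⟨hp1, hp2⟩, hp3, hp4⟩ ⟨⟨hq1, hq2⟩, hq3, hq4⟩ ⟨⟨hr1, hr2⟩, hr3, hr4⟩ hqR hqL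
    have hσ := ho.linExt
    have hP : ∃ u, L u ∧ σ a < σ u ∧ σ u < σ q.1 := by
      rcases hp2.cases h with ⟨h1, h2⟩ | ⟨h1, h2⟩
      · exact ⟨p.1, h1, by omega, by omega⟩
      · refine ⟨p.2, h2, by omega, lt_of_le_of_ne (by omega) fun e => ?_⟩
        rw [hσ.inj e] at h2
        exact h.not_both_inside hσ hab hq3 (by omega) h2 hqR
    have hQ : ∃ u, R u ∧ σ q.2 < σ u ∧ σ u < σ b := by
      rcases hr2.cases h with ⟨h1, h2⟩ | ⟨h1, h2⟩
      · exact ⟨r.2, h2, by omega, by omega⟩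
      · refine ⟨r.1, h1, lt_of_le_of_ne (by omega) fun e => ?_, by omega⟩
        rw [← hσ.inj e] at h1
        exact h.not_both_inside hσ hab (by omega) hq4 hqL h1
    obtain ⟨u, hu, hau, huq⟩ := hP
    obtain ⟨w, hw, hqw, hwb⟩ := hQ
    exact h.no_zigzag ho hab hq1 hq3 hq4 hqR hqL hu
      (fun hR => h.not_both_inside hσ hab hau (by omega) hu hR) hau.le huq (by omega) hw hqw hwb.le
      (by omega)
  have swap : ∀ {x}, x ∈ switchesAround L R σ a b → x ∈ switchesAround R L σ a b := fun hx => by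
    rw [switchesAround, switchPairs_symm]; exact hx
  rcases hq.1.2.cases h with h1 | h1
  · exact key h.symm ho.symm (swap hp) (swap hq) (swap hr) h1.1 h1.2
  · exact key h ho hp hq hr h1.1 h1.2

omit [Finite V] in
theorem switchPairs.eq_of_fst (hσ : LinExt G σ) {p q : V × V} (hp : p ∈ switchPairs L R σ)
    (hq : q ∈ switchPairs L R σ) (h : σ p.1 = σ q.1) : p = q :=
  Prod.ext (hσ.inj h) (hσ.inj (by rw [hp.1, hq.1, h]))

theorem TwoSided.encard_switchesAround_le (h : TwoSided G L R) (ho : OptimalLinExt G L R σ)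
    {a b : V} (hab : G.Adj a b) : (switchesAround L R σ a b).encard ≤ 2 := by
  by_contra hcon
  rw [not_le, ← (Set.toFinite _).cast_ncard_eq] at hcon
  obtain ⟨p, q, r, hp, hq, hr, hpq, hpr, hqr⟩ :=
    (Set.two_lt_ncard_iff (Set.toFinite _)).1 (by exact_mod_cast hcon)
  have hne : ∀ {x y}, x ∈ switchesAround L R σ a b → y ∈ switchesAround L R σ a b → x ≠ y →
      σ x.1 ≠ σ y.1 := fun hx hy hxy e => hxy (switchPairs.eq_of_fst ho.linExt hx.1 hy.1 e)
  have h1 := hne hp hq hpq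
  have h2 := hne hp hr hpr
  have h3 := hne hq hr hqr
  have key := fun {x y z} (hx : x ∈ switchesAround L R σ a b)
    (hy : y ∈ switchesAround L R σ a b) (hz : z ∈ switchesAround L R σ a b) =>
    h.no_three_switches ho hab hx hy hz
  rcases lt_or_gt_of_ne h1 with h1 | h1 <;> rcases lt_or_gt_of_ne h2 with h2 | h2 <;>
    rcases lt_or_gt_of_ne h3 with h3 | h3
  · exact key hp hq hr h1 h3
  · exact key hp hr hq h2 h3
  · omega
  · exact key hr hp hq h2 h1
  · exact key hq hp hr h1 h2
  · omega
  · exact key hq hr hp h3 h2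
  · exact key hr hq hp h3 h1

end

/-! ## Polygons -/

/-- `v` lies on a directed path from `a` to `d`, in its interior. -/
def StrictlyBetween {V : Type*} (G : Digraph V) (a v d : V) : Prop :=
  DirectedPath G a v ∧ DirectedPath G v d ∧ v ≠ a ∧ v ≠ d

/-- The vertices on the directed paths from `a` to `d`. -/
def pathInterval {V : Type*} (G : Digraph V) (a d : V) : Set V :=
  {v | DirectedPath G a v ∧ DirectedPath G v d}

/-- Source and sink of an `st`-polygon on all vertices between them. -/
structure IsPolygonPair {V : Type*} (G : Digraph V) (L R : V → Prop) (a d : V) : Prop where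
  left : ∃ u, L u ∧ StrictlyBetween G a u d
  right : ∃ u, R u ∧ StrictlyBetween G a u d
  separated : ∀ u w, L u → R w → StrictlyBetween G a u d → StrictlyBetween G a w d →
    u ≠ w ∧ ¬ G.Adj u w ∧ ¬ G.Adj w u

theorem IsPolygonPair.symm {V : Type*} {G : Digraph V} {L R : V → Prop} {a d : V}
    (h : IsPolygonPair G L R a d) : IsPolygonPair G R L a d where
  left := h.right
  right := h.left
  separated u w hu hw h1 h2 :=
    have := h.separated w u hw hu h2 h1
    ⟨this.1.symm, this.2.2, this.2.1⟩

/-- A polygon pair whose vertex set is maximal. -/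
def IsMaximalPolygonPair {V : Type*} (G : Digraph V) (L R : V → Prop) (a d : V) : Prop :=
  IsPolygonPair G L R a d ∧
    ∀ a' d', IsPolygonPair G L R a' d' → ¬ pathInterval G a d ⊂ pathInterval G a' d'

theorem IsMaximalPolygonPair.symm {V : Type*} {G : Digraph V} {L R : V → Prop} {a d : V}
    (h : IsMaximalPolygonPair G L R a d) : IsMaximalPolygonPair G R L a d :=
  ⟨h.1.symm, fun a' d' h' => h.2 a' d' h'.symm⟩

/-- An edge from the left side that enters the sink `d` of a polygon, which is on the right
side, with no left vertex of the polygon above it. -/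
structure IsLimitingEdge {V : Type*} (G : Digraph V) (L R : V → Prop) (a d x : V) : Prop where
  adj : G.Adj x d
  left : L x
  right : R d
  not_right : ¬ R x
  path : DirectedPath G a x
  ne : x ≠ a
  last : ∀ l, L l → DirectedPath G x l → DirectedPath G l d → l = x ∨ l = d

section

variable {V : Type*} {G : Digraph V} {L R : V → Prop} {σ : V → ℕ}

/-- Somewhere the path would pass from the left side to the right one, at a vertex on both sides or
along an edge between them, strictly inside the polygon. -/
theorem TwoSided.no_path_across (h : TwoSided G L R) {a d u w : V}
    (hp : IsPolygonPair G L R a d) (hu : L u) (hw : R w) (hau : DirectedPath G a u) (hne : u ≠ a)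
    (huw : DirectedPath G u w) (hwd : DirectedPath G w d) (hne' : w ≠ d) : False := by
  have hd : ∀ v, DirectedPath G v w → v ≠ d := by
    rintro v hv rfl
    exact hne' (h.acyclic.antisymm hwd hv)
  induction huw using Relation.ReflTransGen.head_induction_on with
  | refl => exact (hp.separated w w hu hw ⟨hau, hwd, hne, hne'⟩ ⟨hau, hwd, hne, hne'⟩).1 rfl
  | @head u v huv hvw ih =>
    have huv' : DirectedPath G u v := .single huv
    have hva : v ≠ a := by
      rintro rfl
      exact h.acyclic.not_adj_of_path hau huv
    have hvw' : DirectedPath G v w := hvw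
    rcases h.cover v with hv | hv
    · exact ih hv (hau.trans huv') hva
    · exact (hp.separated u v hu hv ⟨hau, (huv'.trans hvw').trans hwd, hne,
        hd u (huv'.trans hvw')⟩ ⟨hau.trans huv', hvw'.trans hwd, hva, hd v hvw'⟩).2.1 huv

/-- `no_zigzag` applies with `p = x` and `q = d`. Edges from `x` to an inner right vertex are
excluded by the polygon, edges from an inner left vertex to `d` by `IsLimitingEdge.last`. -/
theorem TwoSided.no_switch_down [Finite V] (h : TwoSided G L R) (ho : OptimalLinExt G L R σ)
    {a d x : V} (hp : IsPolygonPair G L R a d) (he : IsLimitingEdge G L R a d x) {p : V × V}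
    (hps : p ∈ switchesAround L R σ x d) : L p.1 ∧ R p.2 := by
  obtain ⟨⟨h1, h2⟩, h3, h4⟩ := hps
  rcases h2.cases h with h5 | ⟨h5, h6⟩
  · exact h5
  exfalso
  have hσ := ho.linExt
  have hxd := hσ.mono _ _ he.adj
  refine h.no_zigzag ho he.adj h1 h3 h4 h5 h6 he.left he.not_right le_rfl h3 (fun _ r hr h7 h8 hadj
    => ?_) he.right h4 le_rfl fun _ l hl h7 h8 hadj => ?_
  · exact (hp.separated x r he.left hr ⟨he.path, .single he.adj, he.ne, hσ.ne hxd⟩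
      ⟨he.path.trans (.single hadj), h.path_of_right hσ hr he.right h8.le, fun e => by
        subst e; exact hσ.not_path h7 he.path, hσ.ne h8⟩).2.1 hadj
  · rcases he.last l hl (h.path_of_left hσ he.left hl h7.le) (.single hadj) with rfl | rfl <;> omega

theorem TwoSided.encard_switchesAround_le_one [Finite V] (h : TwoSided G L R)
    (ho : OptimalLinExt G L R σ) {a d x : V} (hp : IsPolygonPair G L R a d)
    (he : IsLimitingEdge G L R a d x) : (switchesAround L R σ x d).encard ≤ 1 := by
  have hσ := ho.linExt
  have hadj := he.adj
  have key : ∀ p ∈ switchesAround L R σ x d, ∀ q ∈ switchesAround L R σ x d,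
      ¬ σ p.1 < σ q.1 := by
    intro p hpm q hqm hlt
    have h1 := h.no_switch_down ho hp he hpm
    have h2 := h.no_switch_down ho hp he hqm
    obtain ⟨⟨h3, -⟩, h4, h5⟩ := hpm
    obtain ⟨⟨h6, -⟩, h7, h8⟩ := hqm
    -- The last right vertex before the second switch is followed by a left vertex: a switch in the
    -- forbidden direction.
    obtain ⟨r, hr, hmax⟩ := Set.exists_max_image {w | R w ∧ σ w < σ q.1} σ (Set.toFinite _)
      ⟨p.2, h1.2, lt_of_le_of_ne (by omega) fun e => by
        rw [hσ.inj e] at h1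
        exact h.not_both_inside hσ hadj h7 (by omega) h2.1 h1.2⟩
    obtain ⟨hrR, hrq⟩ := hr
    have hpr : σ p.2 ≤ σ r := by
      by_contra hcon
      exact hcon (hmax p.2 ⟨h1.2, lt_of_le_of_ne (by omega) fun e => by
        rw [hσ.inj e] at h1
        exact h.not_both_inside hσ hadj h7 (by omega) h2.1 h1.2⟩)
    obtain ⟨l, hl⟩ := hσ.exists_eq (show σ r + 1 < Nat.card V by have := hσ.lt q.1; omega)
    have hlR : ¬ R l := fun hR => by
      by_cases h9 : σ l < σ q.1
      · have := hmax l ⟨hR, h9⟩; omega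
      · rw [hσ.inj (show σ l = σ q.1 by omega)] at hR
        exact h.not_both_inside hσ hadj h7 (by omega) h2.1 hR
    have hrL : ¬ L r := fun hL =>
      h.not_both_inside hσ hadj (by omega) (by omega) hL hrR
    have := h.no_switch_down ho hp he (p := (r, l))
      ⟨⟨hl, fun hh => hrL hh.1, fun hh => hlR hh.2⟩, by simp only; omega, by simp only; omega⟩
    exact hrL this.1
  refine Set.encard_le_one_iff.2 fun p q hpm hqm => switchPairs.eq_of_fst hσ hpm.1 hqm.1 ?_
  have h1 := key p hpm q hqm
  have h2 := key q hqm p hpm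
  omega

/-- A left vertex above a limiting edge belongs to no maximal polygon with a lower source. -/
theorem TwoSided.not_mem_lower_polygon (h : TwoSided G L R) {a d x l c e : V}
    (hp : IsMaximalPolygonPair G L R a d) (he : IsLimitingEdge G L R a d x) (hl : L l)
    (hxl : DirectedPath G x l) (hne : l ≠ x) (hld : l ≠ d)
    (hq : IsPolygonPair G L R c e) (hca : DirectedPath G c a) :
    ¬ (DirectedPath G c l ∧ DirectedPath G l e) := by
  rintro ⟨-, hle⟩
  have hnld : ¬ DirectedPath G l d := fun hh => (he.last l hl hxl hh).elim hne hld
  -- If `d` is an ancestor of `e`, the polygon from `c` to `e` properly contains the maximal one.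
  -- Otherwise `e` is only on the left, so every path from a right vertex `w` to `e` changes sides.
  by_cases hde : DirectedPath G d e
  · refine hp.2 c e hq (Set.ssubset_iff_of_subset ?_ |>.2 ⟨l, ⟨?_, hle⟩, fun hh => hnld hh.2⟩)
    · exact fun v hv => ⟨hca.trans hv.1, hv.2.trans hde⟩
    · exact (hca.trans he.path).trans hxl
  have heR : ¬ R e := fun hR => by
    rcases h.chain_right d e he.right hR with h1 | h1
    · exact hde h1
    · exact hnld (hle.trans h1)
  have hxe : x ≠ e := by
    rintro rfl
    exact hne (h.acyclic.antisymm hle hxl)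
  have hxc : x ≠ c := by
    rintro rfl
    exact he.ne (h.acyclic.antisymm hca he.path)
  obtain ⟨w, hw, hcw, hwe, hwc, hwe'⟩ := hq.right
  -- the path from `w` to `e` reaches the left side at or below `x`
  have key : ∀ r, DirectedPath G r e → R r → ∃ l', L l' ∧ DirectedPath G r l' ∧
      DirectedPath G l' e ∧ DirectedPath G l' x := by
    intro r hre
    induction hre using Relation.ReflTransGen.head_induction_on with
    | refl => exact fun hR => absurd hR heR
    | @head r r' hrr' hre ih =>
      intro hr
      have hrr'' : DirectedPath G r r' := .single hrr'
      have hre' : DirectedPath G r' e := hre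
      by_cases hr' : R r'
      · obtain ⟨l', h1, h2, h3⟩ := ih hr'
        exact ⟨l', h1, hrr''.trans h2, h3⟩
      have hl' : L r' := (h.cover r').resolve_right hr'
      refine ⟨r', hl', hrr'', hre', by_contra fun hn => ?_⟩
      -- An edge from the right side to a left vertex not leading to `x` would cross `(x, d)`.
      refine h.noncrossing x d r r' he.adj hrr' ⟨?_, .inr (.inr ⟨he.left, hr⟩)⟩
        ⟨?_, .inr (.inr ⟨hl', he.right⟩)⟩ (fun hdr => hde (hdr.trans (hrr''.trans hre'))) hn
      · rintro rfl; exact he.not_right hr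
      · rintro rfl; exact hr' he.right
  obtain ⟨l', -, h2, -, h4⟩ := key w hwe hw
  exact h.symm.no_path_across hq.symm hw he.left hcw hwc (h2.trans h4) (hxl.trans hle) hxe

/-- A right vertex below the upper end of a limiting edge, but not below its lower end, belongs to
a polygon with a lower source. -/
theorem TwoSided.exists_lower_polygon [Finite V] (h : TwoSided G L R) (hσ : LinExt G σ) {s : V}
    (hs : ∀ v, DirectedPath G s v)
    {a d r : V} (hp : IsPolygonPair G L R a d) (hr : R r) (har : σ a < σ r)
    (hrd : DirectedPath G r d) (hrd' : r ≠ d) :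
    ∃ c e, IsPolygonPair G L R c e ∧ DirectedPath G c a ∧ DirectedPath G c r ∧
      DirectedPath G r e := by
  by_cases hr' : DirectedPath G a r
  · exact ⟨a, d, hp, .refl G a, hr', hrd⟩
  have haR : ¬ R a := fun hR => hr' (h.path_of_right hσ hR hr har.le)
  have haL : L a := (h.cover a).resolve_right haR
  have hra : ¬ DirectedPath G r a := hσ.not_path har
  -- an edge from `a` to a right vertex above `r`
  obtain ⟨r₁, hr₁, har₁, hrr₁⟩ : ∃ r₁, R r₁ ∧ G.Adj a r₁ ∧ DirectedPath G r r₁ := by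
    obtain ⟨w, hw, haw, hwd, hwa, hwd'⟩ := hp.right
    obtain ⟨r₁, h1, h2⟩ := haw.exists_head hwa.symm
    have h1' : DirectedPath G a r₁ := .single h1
    have hR : R r₁ := by
      by_contra hR
      exact h.no_path_across hp ((h.cover r₁).resolve_right hR) hw h1'
        (h.acyclic.ne_of_adj h1).symm h2 hwd hwd'
    refine ⟨r₁, hR, h1, ?_⟩
    rcases h.chain_right r r₁ hr hR with h3 | h3
    · exact h3
    · exact absurd (h1'.trans h3) hr'
  have har₁' : DirectedPath G a r₁ := .single har₁
  -- The polygon is built around the incomparable pair `a`, `r`. Its source `c` is a last common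
  -- ancestor of both, `u` is the first left vertex after `c` on the way to `a`, and its sink `e` is
  -- a first common descendant of `u` and `r`; one exists because of `r₁`.
  obtain ⟨c, ⟨hca, hcr⟩, hcmax⟩ := Set.exists_max_image
    {c | DirectedPath G c a ∧ DirectedPath G c r} σ (Set.toFinite _) ⟨s, hs a, hs r⟩
  have hca' : c ≠ a := by rintro rfl; exact hr' hcr
  have hcr' : c ≠ r := by rintro rfl; exact hra hca
  have hcommon : ∀ v, DirectedPath G c v → v ≠ c → DirectedPath G v a → ¬ DirectedPath G v r :=
    fun v h1 h2 h3 h4 => (hcmax v ⟨h3, h4⟩).not_gt (hσ.lt_of_ne h1 h2.symm)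
  obtain ⟨u, ⟨hu, hcu, huc, hua⟩, humin⟩ := Set.exists_min_image
    {u | L u ∧ DirectedPath G c u ∧ u ≠ c ∧ DirectedPath G u a} σ (Set.toFinite _)
    ⟨a, haL, hca, hca'.symm, .refl G a⟩
  have hur : ¬ DirectedPath G u r := hcommon u hcu huc hua
  have hru : ¬ DirectedPath G r u := fun hh => hra (hh.trans hua)
  obtain ⟨e, ⟨hue, hre⟩, hemin⟩ := Set.exists_min_image
    {e | DirectedPath G u e ∧ DirectedPath G r e} σ (Set.toFinite _)
    ⟨r₁, hua.trans har₁', hrr₁⟩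
  have hcommon' : ∀ v, DirectedPath G v e → v ≠ e → DirectedPath G u v → ¬ DirectedPath G r v :=
    fun v h1 h2 h3 h4 => (hemin v ⟨h3, h4⟩).not_gt (hσ.lt_of_ne h1 h2)
  have hlow : ∀ l, L l → DirectedPath G c l → l ≠ c → DirectedPath G u l := by
    intro l hl h1 h2
    rcases h.chain_left u l hu hl with h3 | h3
    · exact h3
    · rw [hσ.inj (le_antisymm (hσ.le h3) (humin l ⟨hl, h1, h2, h3.trans hua⟩))]
      exact .refl G u
  refine ⟨c, e, ⟨⟨u, hu, hcu, hue, huc, ?_⟩, ⟨r, hr, hcr, hre, hcr'.symm, ?_⟩, ?_⟩, hca, hcr, hre⟩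
  · rintro rfl; exact hru hre
  · rintro rfl; exact hur hue
  intro l w hl hw ⟨h1, h2, h3, h4⟩ ⟨h5, h6, h7, h8⟩
  have hul := hlow l hl h1 h3
  have hcase : DirectedPath G w r ∨ DirectedPath G r w := h.chain_right w r hw hr
  refine ⟨?_, fun hadj => ?_, fun hadj => ?_⟩
  · rintro rfl
    rcases hcase with h9 | h9
    · exact hur (hul.trans h9)
    · exact hcommon' l h6 h8 hul h9
  · have hlw := hul.trans (.single hadj)
    rcases hcase with h9 | h9
    · exact hur (hlw.trans h9)
    · exact hcommon' w h6 h8 hlw h9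
  · have hwl : DirectedPath G w l := .single hadj
    rcases hcase with h9 | h9
    · by_cases hla : DirectedPath G l a
      · exact hcommon w h5 h7 (hwl.trans hla) h9
      have hal : DirectedPath G a l := (h.chain_left l a hl haL).resolve_left hla
      -- Beyond `a`, the edge `(w, l)` from right to left would cross `(a, r₁)` from left to right.
      refine h.noncrossing a r₁ w l har₁ hadj ⟨?_, .inr (.inr ⟨haL, hw⟩)⟩
        ⟨?_, .inr (.inr ⟨hl, hr₁⟩)⟩ (fun hh => ?_) hla
      · rintro rfl; exact hr' h9
      · rintro rfl; exact hcommon' l h2 h4 hul hrr₁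
      · have h10 := h.acyclic.antisymm h9 (hrr₁.trans hh)
        have h11 := h.acyclic.antisymm hrr₁ (hh.trans h9)
        exact hr' (h11 ▸ har₁')
    · exact hcommon' l h2 h4 hul (h9.trans hwl)

theorem IsPolygonPair.exists_maximal [Finite V] {a d : V} (hp : IsPolygonPair G L R a d) :
    ∃ a' d', IsMaximalPolygonPair G L R a' d' ∧ pathInterval G a d ⊆ pathInterval G a' d' := by
  obtain ⟨⟨a', d'⟩, ⟨h1, h2⟩, h3⟩ := Set.exists_max_image
    {p : V × V | IsPolygonPair G L R p.1 p.2 ∧ pathInterval G a d ⊆ pathInterval G p.1 p.2}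
    (fun p => (pathInterval G p.1 p.2).ncard) (Set.toFinite _) ⟨(a, d), hp, subset_rfl⟩
  exact ⟨a', d', ⟨h1, fun a'' d'' h4 h5 => (h3 (a'', d'') ⟨h4, h2.trans h5.subset⟩).not_gt
    (Set.ncard_lt_ncard h5 (Set.toFinite _))⟩, h2⟩

end

namespace UpwardDrawing

variable {V : Type*} {G : Digraph V}

/-! ## The mirror image -/

/-- The reflection of a drawing in a vertical line. -/
def mirror (D : UpwardDrawing G) : UpwardDrawing G where
  x v := -D.x v
  y := D.y
  curve u v h := -D.curve u v h
  distinct u v h := D.distinct (by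
    obtain ⟨h1, h2⟩ := Prod.mk.inj h
    exact Prod.ext (neg_injective h1) h2)
  upward := D.upward
  cont u v h := (D.cont u v h).neg
  curve_start u v h := by rw [D.curve_start u v h]
  curve_end u v h := by rw [D.curve_end u v h]
  avoids u v h w h1 h2 h3 h4 := D.avoids u v h w h1 h2 h3 (neg_injective h4)

theorem mirror_onLeft {D : UpwardDrawing G} {v : V} : D.mirror.OnLeft v ↔ D.OnRight v :=
  forall_congr' fun _ => forall_congr' fun _ => imp_congr_right fun _ => imp_congr_right fun _ =>
    neg_le_neg_iff

theorem mirror_onRight {D : UpwardDrawing G} {v : V} : D.mirror.OnRight v ↔ D.OnLeft v :=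
  forall_congr' fun _ => forall_congr' fun _ => imp_congr_right fun _ => imp_congr_right fun _ =>
    neg_le_neg_iff

theorem mirror_meetHeights (D : UpwardDrawing G) (e f : V × V) :
    D.mirror.meetHeights e f = D.meetHeights e f := by
  ext h
  exact and_congr_right fun _ => and_congr_right fun _ => neg_inj

theorem IsPlanar.mirror {D : UpwardDrawing G} (h : D.IsPlanar) : D.mirror.IsPlanar := by
  unfold IsPlanar crossings at *
  simp only [mirror_meetHeights]
  exact h

theorem SameEmbedding.mirror {D D' : UpwardDrawing G} (h : D.SameEmbedding D') :
    D.mirror.SameEmbedding D'.mirror := by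
  have h1 : ∀ (D : UpwardDrawing G) u v w, D.mirror.OutLeft u v w ↔ D.OutLeft u w v := fun D u v w =>
    eventually_congr (Eventually.of_forall fun _ => neg_lt_neg_iff)
  have h2 : ∀ (D : UpwardDrawing G) u v w, D.mirror.InLeft u v w ↔ D.InLeft v u w := fun D u v w =>
    eventually_congr (Eventually.of_forall fun _ => neg_lt_neg_iff)
  refine ⟨fun u v w hv hw => ?_, fun u v w hv hw => ?_⟩
  · rw [h1, h1]; exact h.1 u w v hw hv
  · rw [h2, h2]; exact h.2 v u w hw hv

/-! ## Heights -/

theorem y_le_of_path (D : UpwardDrawing G) {u v : V} (h : DirectedPath G u v) :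
    D.y u ≤ D.y v := by
  induction h with
  | refl => exact le_rfl
  | tail _ h ih => exact ih.trans (D.upward _ _ h).le

theorem y_lt_of_path (D : UpwardDrawing G) {u v : V} (h : DirectedPath G u v) (hne : u ≠ v) :
    D.y u < D.y v := by
  obtain ⟨w, h1, h2⟩ := h.exists_head hne
  exact (D.upward _ _ h1).trans_le (D.y_le_of_path h2)

theorem acyclicDigraph (D : UpwardDrawing G) : AcyclicDigraph G := by
  intro v hv
  obtain ⟨w, h1, h2⟩ := Relation.TransGen.head'_iff.1 hv
  exact ((D.upward _ _ h1).trans_le (D.y_le_of_path h2)).false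

theorem left_mem (D : UpwardDrawing G) {u v : V} (h : G.Adj u v) :
    D.y u ∈ Icc (D.y u) (D.y v) := ⟨le_rfl, (D.upward _ _ h).le⟩

theorem right_mem (D : UpwardDrawing G) {u v : V} (h : G.Adj u v) :
    D.y v ∈ Icc (D.y u) (D.y v) := ⟨(D.upward _ _ h).le, le_rfl⟩

/-- An edge on a path at a given height. -/
theorem exists_edge_at_height (D : UpwardDrawing G) {u v : V} {h : ℝ} (hp : DirectedPath G u v)
    (hu : D.y u ≤ h) (hv : h < D.y v) :
    ∃ c d, G.Adj c d ∧ DirectedPath G u c ∧ DirectedPath G d v ∧ D.y c ≤ h ∧ h < D.y d := by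
  induction hp using Relation.ReflTransGen.head_induction_on with
  | refl => exact absurd hv hu.not_gt
  | @head u w huw hwv ih =>
    by_cases hw : D.y w ≤ h
    · obtain ⟨c, d, h1, h2, h3⟩ := ih hw
      exact ⟨c, d, h1, (DirectedPath.single huw).trans h2, h3⟩
    · exact ⟨u, w, huw, .refl G u, hwv, hu, not_le.1 hw⟩

/-! ## Planarity -/

theorem IsPlanar.eq_of_meet {D : UpwardDrawing G} (hD : D.IsPlanar) {a b c d : V}
    (hab : G.Adj a b) (hcd : G.Adj c d) {h : ℝ} (h1 : h ∈ Ioo (D.y a) (D.y b))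
    (h2 : h ∈ Ioo (D.y c) (D.y d)) (h3 : D.curve a b h = D.curve c d h) : a = c ∧ b = d := by
  by_contra hne
  have : (s((a, b), (c, d)), h) ∈ D.crossings :=
    ⟨(a, b), (c, d), hab, hcd, fun e => hne (Prod.mk.inj e), rfl, h1, h2, h3⟩
  rw [hD] at this
  exact this

/-- In a planar drawing the order of two edges from left to right does not change. -/
theorem IsPlanar.lt_of_lt {D : UpwardDrawing G} (hD : D.IsPlanar) {a b c d : V}
    (hab : G.Adj a b) (hcd : G.Adj c d) {h h' : ℝ} (hne : b = d → h' < D.y b)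
    (h1 : h ∈ Icc (D.y a) (D.y b)) (h2 : h ∈ Icc (D.y c) (D.y d))
    (h1' : h' ≤ D.y b) (h2' : h' ≤ D.y d) (hh : h ≤ h')
    (hlt : D.curve a b h < D.curve c d h) : D.curve a b h' < D.curve c d h' := by
  by_contra hge
  have hc1 : ContinuousOn (D.curve a b) (Icc h h') :=
    (D.cont a b hab).mono (Icc_subset_Icc h1.1 h1')
  have hc2 : ContinuousOn (D.curve c d) (Icc h h') :=
    (D.cont c d hcd).mono (Icc_subset_Icc h2.1 h2')
  -- If the order changed, the curves would meet: either in a common inner point, or with one curve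
  -- passing through the head of the other. The hypothesis `hne` excludes meeting at a common head.
  obtain ⟨k, hk, hk0⟩ := intermediate_value_Icc' hh (hc2.sub hc1)
    (show (0 : ℝ) ∈ _ from ⟨sub_nonpos.2 (not_lt.1 hge), (sub_pos.2 hlt).le⟩)
  have hk0 : D.curve c d k = D.curve a b k := sub_eq_zero.1 hk0
  have hhk : h < k := lt_of_le_of_ne hk.1 fun e => by
    subst e
    exact hlt.ne hk0.symm
  have hkb := hk.2.trans h1'
  have hkd := hk.2.trans h2'
  rcases hkb.lt_or_eq with hkb | hkb
  · rcases hkd.lt_or_eq with hkd | hkd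
    · obtain ⟨rfl, rfl⟩ := hD.eq_of_meet hab hcd ⟨h1.1.trans_lt hhk, hkb⟩ ⟨h2.1.trans_lt hhk, hkd⟩
        hk0.symm
      exact hlt.false
    · refine D.avoids a b hab d (fun e => ?_) (fun e => ?_) (hkd ▸ ⟨h1.1.trans hhk.le, hkb.le⟩) ?_
      · subst e; linarith [h1.1]
      · subst e; linarith
      · rw [← hkd, ← hk0, hkd, D.curve_end c d hcd]
  · refine D.avoids c d hcd b (fun e => ?_) (fun e => ?_) (hkb ▸ ⟨h2.1.trans hhk.le, hkd⟩) ?_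
    · subst e; linarith [h2.1]
    · have := hne e; linarith [hk.2]
    · rw [← hkb, hk0, hkb, D.curve_end a b hab]

theorem IsPlanar.outLeft_total {D : UpwardDrawing G} (hD : D.IsPlanar) {u v w : V}
    (hv : G.Adj u v) (hw : G.Adj u w) (hne : v ≠ w) : D.OutLeft u v w ∨ D.OutLeft u w v := by
  have key : ∀ {v w h}, G.Adj u v → G.Adj u w → v ≠ w → D.y u < h → h < D.y v → h < D.y w →
      D.curve u v h < D.curve u w h → D.OutLeft u v w := by
    intro v w h hv hw hne h1 h2 h3 hlt
    filter_upwards [Ioo_mem_nhdsGT h1] with k hk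
    refine lt_of_le_of_ne (not_lt.1 fun hgt => hlt.not_gt ?_) fun e => ?_
    · exact hD.lt_of_lt hw hv (fun e => absurd e.symm hne) ⟨hk.1.le, (hk.2.trans h3).le⟩
        ⟨hk.1.le, (hk.2.trans h2).le⟩ h3.le h2.le hk.2.le hgt
    · exact hne (hD.eq_of_meet hv hw ⟨hk.1, hk.2.trans h2⟩ ⟨hk.1, hk.2.trans h3⟩ e).2
  obtain ⟨h, h1, h2⟩ := exists_between (lt_min (D.upward _ _ hv) (D.upward _ _ hw))
  obtain ⟨h2, h3⟩ := lt_min_iff.1 h2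
  rcases lt_trichotomy (D.curve u v h) (D.curve u w h) with hlt | heq | hgt
  · exact .inl (key hv hw hne h1 h2 h3 hlt)
  · exact absurd (hD.eq_of_meet hv hw ⟨h1, h2⟩ ⟨h1, h3⟩ heq).2 hne
  · exact .inr (key hw hv hne.symm h1 h3 h2 hgt)

theorem IsPlanar.inLeft_total {D : UpwardDrawing G} (hD : D.IsPlanar) {u v w : V}
    (hu : G.Adj u w) (hv : G.Adj v w) (hne : u ≠ v) : D.InLeft u v w ∨ D.InLeft v u w := by
  have key : ∀ {u v h}, G.Adj u w → G.Adj v w → D.y u < h → D.y v < h → h < D.y w →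
      D.curve u w h < D.curve v w h → D.InLeft u v w := by
    intro u v h hu hv h1 h2 h3 hlt
    filter_upwards [Ioo_mem_nhdsLT h3] with k hk
    exact hD.lt_of_lt hu hv (fun _ => hk.2) ⟨h1.le, h3.le⟩ ⟨h2.le, h3.le⟩ hk.2.le hk.2.le hk.1.le
      hlt
  obtain ⟨h, h1, h3⟩ := exists_between (max_lt (D.upward _ _ hu) (D.upward _ _ hv))
  obtain ⟨h1, h2⟩ := max_lt_iff.1 h1
  rcases lt_trichotomy (D.curve u w h) (D.curve v w h) with hlt | heq | hgt
  · exact .inl (key hu hv h1 h2 h3 hlt)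
  · exact absurd (hD.eq_of_meet hu hv ⟨h1, h3⟩ ⟨h2, h3⟩ heq).1 hne
  · exact .inr (key hv hu h2 h1 h3 hgt)

/-- Sweeping upwards from an edge to the left of an edge on a path to `v`: a family of edges which
never lead to `v` and continue up to the height of `v` passes `v` on the left. -/
theorem IsPlanar.sweep [Finite V] {D : UpwardDrawing G} (hD : D.IsPlanar) {v : V}
    {A : V → V → Prop} (hA : ∀ a b, A a b → G.Adj a b ∧ ¬ DirectedPath G b v)
    (hnext : ∀ a b, A a b → D.y b < D.y v → ∃ b', A b b') {a b c d : V} {h : ℝ} (hab : A a b)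
    (hcd : G.Adj c d) (hdv : DirectedPath G d v) (h1 : h ∈ Icc (D.y a) (D.y b))
    (h2 : h ∈ Icc (D.y c) (D.y d)) (hlt : D.curve a b h < D.curve c d h) :
    ∃ a b, A a b ∧ D.y v ∈ Icc (D.y a) (D.y b) ∧ D.curve a b (D.y v) < D.x v := by
  -- The sweep always replaces the edge that ends first. The number of vertices above the head of
  -- that edge drops, so the sum for both edges decreases.
  have hμ : ∀ {b b' : V}, D.y b < D.y b' → {w | D.y b' < D.y w}.ncard < {w | D.y b < D.y w}.ncard :=
    fun {b b'} hb => Set.ncard_lt_ncard ((Set.ssubset_iff_of_subset fun w hw => hb.trans hw).2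
      ⟨b', hb, lt_irrefl (D.y b')⟩) (Set.toFinite _)
  induction hn : {w | D.y b < D.y w}.ncard + {w | D.y d < D.y w}.ncard using Nat.strong_induction_on
    generalizing a b c d h with
  | _ n ih =>
    obtain ⟨hab', hbv⟩ := hA a b hab
    have hne : b ≠ d := fun e => hbv (e ▸ hdv)
    rcases lt_or_ge (D.y b) (D.y d) with hbd | hbd
    · obtain ⟨b', hb'⟩ := hnext a b hab (hbd.trans_le (D.y_le_of_path hdv))
      have hadj := (hA b b' hb').1
      have := hD.lt_of_lt hab' hcd (fun e => absurd e hne) h1 h2 le_rfl hbd.le h1.2 hlt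
      refine ih _ ?_ hb' hcd hdv (D.left_mem hadj) ⟨h2.1.trans h1.2, hbd.le⟩ ?_ rfl
      · have := hμ (D.upward _ _ hadj)
        omega
      · rwa [D.curve_start b b' hadj, ← D.curve_end a b hab']
    · have := hD.lt_of_lt hab' hcd (fun e => absurd e hne) h1 h2 hbd le_rfl h2.2 hlt
      rw [D.curve_end c d hcd] at this
      by_cases hdv' : d = v
      · subst hdv'
        exact ⟨a, b, hab, ⟨h1.1.trans h2.2, hbd⟩, this⟩
      · obtain ⟨d', hd', hd'v⟩ := hdv.exists_head hdv'
        refine ih _ ?_ hab hd' hd'v ⟨h1.1.trans h2.2, hbd⟩ (D.left_mem hd') ?_ rfl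
        · have := hμ (D.upward _ _ hd')
          omega
        · rwa [D.curve_start d d' hd']

end UpwardDrawing

/-! ## `st`-digraphs -/

theorem IsSTDigraph.path_from_source {V : Type*} [Finite V] {G : Digraph V} {s t : V}
    (h : IsSTDigraph G s t) (D : UpwardDrawing G) (v : V) : DirectedPath G s v := by
  by_contra hv
  obtain ⟨w, hw, hmin⟩ := Set.exists_min_image {v | ¬ DirectedPath G s v} D.y (Set.toFinite _)
    ⟨v, hv⟩
  have hws : w ≠ s := by rintro rfl; exact hw (.refl G w)
  have := mt (h.source w).1 hws
  push Not at this
  obtain ⟨u, hu⟩ := this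
  exact (D.upward u w hu).not_ge (hmin u fun hsu => hw (hsu.trans (.single hu)))

theorem IsSTDigraph.path_to_sink {V : Type*} [Finite V] {G : Digraph V} {s t : V}
    (h : IsSTDigraph G s t) (D : UpwardDrawing G) (v : V) : DirectedPath G v t := by
  by_contra hv
  obtain ⟨w, hw, hmax⟩ := Set.exists_max_image {v | ¬ DirectedPath G v t} D.y (Set.toFinite _)
    ⟨v, hv⟩
  have hws : w ≠ t := by rintro rfl; exact hw (.refl G w)
  have := mt (h.sink w).1 hws
  push Not at this
  obtain ⟨u, hu⟩ := this
  exact (D.upward w u hu).not_ge (hmax u fun hsu => hw ((DirectedPath.single hu).trans hsu))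

theorem IsSTDigraph.exists_next {V : Type*} [Finite V] {G : Digraph V} {s t : V}
    (h : IsSTDigraph G s t) (D : UpwardDrawing G) {v w : V} (hlt : D.y v < D.y w) :
    ∃ u, G.Adj v u := by
  have hv : v ≠ t := by
    rintro rfl
    exact hlt.not_ge (D.y_le_of_path (h.path_to_sink D w))
  have := mt (h.sink v).1 hv
  push Not at this
  exact this

namespace UpwardDrawing

variable {V : Type*} {G : Digraph V}

/-! ### From drawings to two-sided digraphs -/

theorem OnLeft.lt_curve {D : UpwardDrawing G} {v a b : V} (hv : D.OnLeft v) (hab : G.Adj a b)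
    (ha : v ≠ a) (hb : v ≠ b) (h : D.y v ∈ Icc (D.y a) (D.y b)) :
    D.x v < D.curve a b (D.y v) :=
  lt_of_le_of_ne (hv a b hab h) (D.avoids a b hab v ha hb h).symm

theorem OnRight.curve_lt {D : UpwardDrawing G} {v a b : V} (hv : D.OnRight v) (hab : G.Adj a b)
    (ha : v ≠ a) (hb : v ≠ b) (h : D.y v ∈ Icc (D.y a) (D.y b)) :
    D.curve a b (D.y v) < D.x v :=
  lt_of_le_of_ne (hv a b hab h) (D.avoids a b hab v ha hb h)

/-- If `u` did not lead to `v`, edges out of descendants of `u` could be followed up to the height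
of `v`. They start to the left of a path from `s` to `v` and stay there, so `v` would not be on the
left side. -/
theorem IsPlanar.path_of_onLeft [Finite V] {D : UpwardDrawing G} (hD : D.IsPlanar) {s t : V}
    (hst : IsSTDigraph G s t) {u v : V} (hu : D.OnLeft u) (hv : D.OnLeft v)
    (huv : D.y u ≤ D.y v) : DirectedPath G u v := by
  by_contra hn
  have hne : u ≠ v := by rintro rfl; exact hn (.refl G u)
  rcases huv.lt_or_eq with hlt | heq
  · obtain ⟨b, hb⟩ := hst.exists_next D hlt
    obtain ⟨c, d, hcd, -, hdv, h1, h2⟩ := D.exists_edge_at_height (hst.path_from_source D v)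
      (D.y_le_of_path (hst.path_from_source D u)) hlt
    have huc : u ≠ c := by
      rintro rfl
      exact hn ((DirectedPath.single hcd).trans hdv)
    have hud : u ≠ d := by rintro rfl; exact h2.false
    obtain ⟨a, b, ⟨-, hab⟩, h3, h4⟩ := hD.sweep (v := v)
      (A := fun a b => DirectedPath G u a ∧ G.Adj a b)
      (fun a b h => ⟨h.2, fun hbv => hn ((h.1.trans (.single h.2)).trans hbv)⟩)
      (fun a b h hlt => (hst.exists_next D hlt).imp fun b' hb' => ⟨h.1.trans (.single h.2), hb'⟩)
      (a := u) (b := b) (h := D.y u) ⟨.refl G u, hb⟩ hcd hdv (D.left_mem hb) ⟨h1, h2.le⟩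
      (by rw [D.curve_start u b hb]; exact hu.lt_curve hcd huc hud ⟨h1, h2.le⟩)
    exact (hv a b hab h3).not_gt h4
  -- At equal heights each vertex is at or to the left of an edge entering the other, so the two
  -- points coincide.
  · have key : ∀ {u v}, D.OnLeft u → u ≠ v → D.y u = D.y v → D.x u ≤ D.x v := by
      intro u v hu hne heq
      have hvs : s ≠ v := by
        rintro rfl
        exact (D.y_lt_of_path (hst.path_from_source D u) hne.symm).ne' heq
      obtain ⟨w, -, hwv⟩ := (hst.path_from_source D v).exists_tail hvs
      have := hu w v hwv (by rw [heq]; exact D.right_mem hwv)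
      rwa [heq, D.curve_end w v hwv] at this
    exact hne (D.distinct (Prod.ext (le_antisymm (key hu hne heq) (key hv hne.symm heq.symm)) heq))

theorem IsPlanar.path_of_onRight [Finite V] {D : UpwardDrawing G} (hD : D.IsPlanar) {s t : V}
    (hst : IsSTDigraph G s t) {u v : V} (hu : D.OnRight u) (hv : D.OnRight v)
    (huv : D.y u ≤ D.y v) : DirectedPath G u v :=
  hD.mirror.path_of_onLeft hst (mirror_onLeft.2 hu) (mirror_onLeft.2 hv) huv

/-- For noncrossing, disjoint height ranges contradict the assumed orders. Otherwise the order of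
the edges at the higher tail persists, by planarity, up to the lower head, where the order of the
heads is opposite. -/
theorem IsOuterplanarST.twoSided [Finite V] {D : UpwardDrawing G} {s t : V}
    (h : D.IsOuterplanarST s t) : TwoSided G D.OnLeft D.OnRight := by
  have hL : ∀ {u v}, D.OnLeft u → D.OnLeft v → D.y u ≤ D.y v → DirectedPath G u v :=
    h.planar.path_of_onLeft h.st
  have hR : ∀ {u v}, D.OnRight u → D.OnRight v → D.y u ≤ D.y v → DirectedPath G u v :=
    h.planar.path_of_onRight h.st
  refine ⟨h.st.acyclic, h.outer, fun u v hu hv => ?_, fun u v hu hv => ?_, ?_, ?_⟩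
  · exact (le_total (D.y u) (D.y v)).imp (hL hu hv) (hL hv hu)
  · exact (le_total (D.y u) (D.y v)).imp (hR hu hv) (hR hv hu)
  · intro a b v hab hav hvb hva hvb' hvL hvR
    have hm : D.y v ∈ Icc (D.y a) (D.y b) := ⟨D.y_le_of_path hav, D.y_le_of_path hvb⟩
    exact (hvL.lt_curve hab hva hvb' hm).not_gt (hvR.curve_lt hab hva hvb' hm)
  intro a b c d hab hcd ⟨hac, htail⟩ ⟨hdb, hhead⟩ hbc hda
  have hup := D.upward a b hab
  have hup' := D.upward c d hcd
  have hbc' : b ≠ c := by rintro rfl; exact hbc (.refl G b)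
  have hda' : d ≠ a := by rintro rfl; exact hda (.refl G d)
  have hle := fun {u v} (hp : DirectedPath G u v) => D.y_le_of_path hp
  rcases le_or_gt (D.y b) (D.y c) with hlow | hlow
  · have h1 : ¬ (D.OnLeft b ∧ D.OnLeft c) := fun hh => hbc (hL hh.1 hh.2 hlow)
    have h2 : ¬ (D.OnRight b ∧ D.OnRight c) := fun hh => hbc (hR hh.1 hh.2 hlow)
    have h3 : ¬ DirectedPath G c a := fun hp => by have := hle hp; linarith
    have h4 : ¬ DirectedPath G d b := fun hp => by have := hle hp; linarith
    tauto
  rcases le_or_gt (D.y d) (D.y a) with hlow' | hlow'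
  · have h1 : ¬ (D.OnLeft d ∧ D.OnLeft a) := fun hh => hda (hL hh.1 hh.2 hlow')
    have h2 : ¬ (D.OnRight d ∧ D.OnRight a) := fun hh => hda (hR hh.1 hh.2 hlow')
    have h3 : ¬ DirectedPath G a c := fun hp => by have := hle hp; linarith
    have h4 : ¬ DirectedPath G b d := fun hp => by have := hle hp; linarith
    have h5 := h.outer d
    tauto
  obtain ⟨m, ham, hcm, hmb, hmd, hm⟩ : ∃ m, D.y a ≤ m ∧ D.y c ≤ m ∧ m < D.y b ∧ m < D.y d ∧
      D.curve a b m < D.curve c d m := by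
    rcases le_or_gt (D.y c) (D.y a) with hca | hca
    · have h1 : ¬ DirectedPath G a c := fun hp => (D.y_lt_of_path hp hac).not_ge hca
      have h2 : D.OnLeft a := by tauto
      refine ⟨D.y a, le_rfl, hca, hup, hlow', ?_⟩
      rw [D.curve_start a b hab]
      exact h2.lt_curve hcd hac hda'.symm ⟨hca, hlow'.le⟩
    · have h1 : ¬ DirectedPath G c a := fun hp => (hle hp).not_gt hca
      have h2 : D.OnRight c := by tauto
      refine ⟨D.y c, hca.le, le_rfl, hlow, hup', ?_⟩
      rw [D.curve_start c d hcd]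
      exact h2.curve_lt hab hac.symm hbc'.symm ⟨hca.le, hlow.le⟩
  have hfwd : ∀ {M}, m ≤ M → M ≤ D.y b → M ≤ D.y d → D.curve a b M < D.curve c d M :=
    fun h1 h2 h3 => h.planar.lt_of_lt hab hcd (fun e => absurd e.symm hdb) ⟨ham, hmb.le⟩
      ⟨hcm, hmd.le⟩ h2 h3 h1 hm
  rcases le_or_gt (D.y d) (D.y b) with hdb' | hdb'
  · have h1 : ¬ DirectedPath G b d := fun hp => (D.y_lt_of_path hp hdb.symm).not_ge hdb'
    have h2 : D.OnLeft d := by tauto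
    have h3 := h2.lt_curve hab hda' hdb ⟨hlow'.le, hdb'⟩
    have h4 := hfwd hmd.le hdb' le_rfl
    rw [D.curve_end c d hcd] at h4
    exact h3.not_gt h4
  · have h1 : ¬ DirectedPath G d b := fun hp => (hle hp).not_gt hdb'
    have h2 : D.OnRight b := by tauto
    have h3 := h2.curve_lt hcd hbc' hdb.symm ⟨hlow.le, hdb'.le⟩
    have h4 := hfwd hmb.le le_rfl hdb'.le
    rw [D.curve_end a b hab] at h4
    exact h3.not_gt h4

/-! ## The sides of an embedding -/

/-- Together with `exists_outLeft_of_not_onLeft` this describes the left side by the order of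
outgoing edges alone, so that equal embeddings have equal sides. -/
theorem IsPlanar.not_onLeft_of_outLeft [Finite V] {D : UpwardDrawing G} (hD : D.IsPlanar)
    {s t : V} (hst : IsSTDigraph G s t) {v u p q : V} (hp : G.Adj u p) (hq : G.Adj u q)
    (hpq : D.OutLeft u p q) (hqv : DirectedPath G q v) (hpv : ¬ DirectedPath G p v) :
    ¬ D.OnLeft v := by
  intro hv
  obtain ⟨h, hlt, h1, h2⟩ := (hpq.and (Ioo_mem_nhdsGT
    (lt_min (D.upward _ _ hp) (D.upward _ _ hq)))).exists
  obtain ⟨h2, h3⟩ := lt_min_iff.1 h2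
  obtain ⟨a, b, ⟨hab, -⟩, h4, h5⟩ := hD.sweep (v := v)
    (A := fun a b => G.Adj a b ∧ ¬ DirectedPath G b v) (fun _ _ h => h)
    (fun a b h hlt => (hst.exists_next D hlt).imp fun b' hb' =>
      ⟨hb', fun hh => h.2 ((DirectedPath.single hb').trans hh)⟩)
    ⟨hp, hpv⟩ hq hqv ⟨h1.le, h2.le⟩ ⟨h1.le, h3.le⟩ hlt
  exact (hv a b hab h4).not_gt h5

theorem exists_last_ancestor {a c d v : V} (hav : DirectedPath G a v)
    (hac : DirectedPath G a c) (hcd : G.Adj c d) (hdv : ¬ DirectedPath G d v) :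
    ∃ u p, G.Adj u p ∧ DirectedPath G u v ∧ ¬ DirectedPath G p v ∧
      (u = c ∧ p = d ∨ DirectedPath G p c) := by
  induction hac using Relation.ReflTransGen.head_induction_on with
  | refl => exact ⟨c, d, hcd, hav, hdv, .inl ⟨rfl, rfl⟩⟩
  | @head a b hab hbc ih =>
    by_cases hbv : DirectedPath G b v
    · exact ih hbv
    · exact ⟨a, b, hab, hav, hbv, .inr hbc⟩

/-- Some edge `(c, d)` passes `v` on the left. The required branching is where a path from `s`
through this edge stops leading to `v`. Branching off to the right, it would pass `v` on the right
by a mirrored sweep. -/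
theorem IsPlanar.exists_outLeft_of_not_onLeft [Finite V] {D : UpwardDrawing G} (hD : D.IsPlanar)
    {s t : V} (hst : IsSTDigraph G s t) {v : V} (hv : ¬ D.OnLeft v) :
    ∃ u p q, G.Adj u p ∧ G.Adj u q ∧ D.OutLeft u p q ∧ DirectedPath G q v ∧
      ¬ DirectedPath G p v := by
  unfold OnLeft at hv
  push Not at hv
  obtain ⟨c, d, hcd, hm, hlt⟩ := hv
  have hdv : ¬ DirectedPath G d v := fun hp => by
    by_cases e : d = v
    · subst e
      rw [D.curve_end c d hcd] at hlt
      exact hlt.false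
    · exact (D.y_lt_of_path hp e).not_ge hm.2
  obtain ⟨u, p, hup, huv, hpv, hcase⟩ := exists_last_ancestor (hst.path_from_source D v)
    (hst.path_from_source D c) hcd hdv
  have huc : DirectedPath G u c := by
    rcases hcase with ⟨rfl, -⟩ | h
    · exact .refl G u
    · exact (DirectedPath.single hup).trans h
  have huv' : u ≠ v := by
    rintro rfl
    by_cases e : u = c
    · subst e
      rw [D.curve_start u d hcd] at hlt
      exact hlt.false
    · exact (D.y_lt_of_path huc e).not_ge hm.1
  obtain ⟨q, huq, hqv⟩ := huv.exists_head huv'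
  have hpq : p ≠ q := fun e => hpv (e ▸ hqv)
  refine ⟨u, p, q, hup, huq, (hD.outLeft_total hup huq hpq).resolve_right fun hqp => ?_, hqv, hpv⟩
  obtain ⟨h, hlt', h1, h2⟩ := (hqp.and (Ioo_mem_nhdsGT
    (lt_min (D.upward _ _ hup) (D.upward _ _ huq)))).exists
  obtain ⟨h2, h3⟩ := lt_min_iff.1 h2
  obtain ⟨a, b, ⟨hab, -, hbc⟩, h4, h5⟩ := hD.mirror.sweep (v := v)
    (A := fun a b => G.Adj a b ∧ ¬ DirectedPath G b v ∧ (DirectedPath G b c ∨ a = c ∧ b = d))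
    (fun _ _ h => ⟨h.1, h.2.1⟩) (by
      rintro a b ⟨hab, hbv, hbc | ⟨rfl, rfl⟩⟩ hlt
      · by_cases e : b = c
        · subst e
          exact ⟨d, hcd, hdv, .inr ⟨rfl, rfl⟩⟩
        · obtain ⟨b', hb', hb'c⟩ := hbc.exists_head e
          exact ⟨b', hb', fun hh => hbv ((DirectedPath.single hb').trans hh), .inl hb'c⟩
      · exact absurd hm.2 (not_le.2 hlt))
    (a := u) (b := p) ⟨hup, hpv, hcase.symm⟩ huq hqv ⟨h1.le, h2.le⟩ ⟨h1.le, h3.le⟩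
    (neg_lt_neg hlt')
  have h5 : D.x v < D.curve a b (D.y v) := neg_lt_neg_iff.1 h5
  have h4 : D.y v ∈ Icc (D.y a) (D.y b) := h4
  rcases hbc with hbc | ⟨rfl, rfl⟩
  · have hbc' : b = c := by
      by_contra e
      exact ((D.y_lt_of_path hbc e).trans_le hm.1).not_ge h4.2
    subst hbc'
    have hy : D.y v = D.y b := le_antisymm h4.2 hm.1
    rw [hy, D.curve_end a b hab] at h5
    rw [hy, D.curve_start b d hcd] at hlt
    exact hlt.not_gt h5
  · exact hlt.not_gt h5

theorem SameEmbedding.onLeft [Finite V] {D D' : UpwardDrawing G} (h : D.SameEmbedding D')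
    (hD : D.IsPlanar) (hD' : D'.IsPlanar) {s t : V} (hst : IsSTDigraph G s t) {v : V}
    (hv : D.OnLeft v) : D'.OnLeft v := by
  by_contra hn
  obtain ⟨u, p, q, hp, hq, hpq, hqv, hpv⟩ := hD'.exists_outLeft_of_not_onLeft hst hn
  exact hD.not_onLeft_of_outLeft hst hp hq ((h.1 u p q hp hq).2 hpq) hqv hpv hv

theorem SameEmbedding.onRight [Finite V] {D D' : UpwardDrawing G} (h : D.SameEmbedding D')
    (hD : D.IsPlanar) (hD' : D'.IsPlanar) {s t : V} (hst : IsSTDigraph G s t) {v : V}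
    (hv : D.OnRight v) : D'.OnRight v :=
  mirror_onLeft.1 (h.mirror.onLeft hD.mirror hD'.mirror hst (mirror_onLeft.2 hv))

/-! ## The order of edges at a vertex -/

/-- The order at the start persists up to the lower head, which therefore cannot be on the side
facing the other edge. -/
theorem IsOuterplanarST.headLeft_of_outLeft [Finite V] {D : UpwardDrawing G} {s t : V}
    (h : D.IsOuterplanarST s t) {u v w : V} (hv : G.Adj u v) (hw : G.Adj u w)
    (hvw : D.OutLeft u v w) : HeadLeft G D.OnLeft D.OnRight v w := by
  have hne : v ≠ w := by
    rintro rfl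
    exact (hvw.exists).elim fun _ hh => hh.false
  refine ⟨hne, ?_⟩
  obtain ⟨k, hlt, h1, h2⟩ := (hvw.and (Ioo_mem_nhdsGT
    (lt_min (D.upward _ _ hv) (D.upward _ _ hw)))).exists
  obtain ⟨h2, h3⟩ := lt_min_iff.1 h2
  have hfwd : ∀ {M}, k ≤ M → M ≤ D.y v → M ≤ D.y w → D.curve u v M < D.curve u w M :=
    fun h4 h5 h6 => h.planar.lt_of_lt hv hw (fun e => absurd e hne) ⟨h1.le, h2.le⟩
      ⟨h1.le, h3.le⟩ h5 h6 h4 hlt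
  have hL := fun hh => h.planar.path_of_onLeft h.st (u := v) (v := w) hh
  have hR := fun hh => h.planar.path_of_onRight h.st (u := w) (v := v) hh
  have hc := h.outer v
  have hc' := h.outer w
  rcases le_total (D.y v) (D.y w) with hle | hle
  · have : ¬ D.OnRight v := fun hvR => by
      have h4 := hvR.curve_lt hw (D.acyclicDigraph.ne_of_adj hv).symm hne
        ⟨(D.upward _ _ hv).le, hle⟩
      have h5 := hfwd h2.le le_rfl hle
      rw [D.curve_end u v hv] at h5
      exact h4.not_gt h5
    tauto
  · have : ¬ D.OnLeft w := fun hwL => by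
      have h4 := hwL.lt_curve hv (D.acyclicDigraph.ne_of_adj hw).symm hne.symm
        ⟨(D.upward _ _ hw).le, hle⟩
      have h5 := hfwd h3.le hle le_rfl
      rw [D.curve_end u w hw] at h5
      exact h4.not_gt h5
    tauto

theorem IsOuterplanarST.tailLeft_of_inLeft [Finite V] {D : UpwardDrawing G} {s t : V}
    (h : D.IsOuterplanarST s t) {u v w : V} (hu : G.Adj u w) (hv : G.Adj v w)
    (huv : D.InLeft u v w) : TailLeft G D.OnLeft D.OnRight u v := by
  have hne : u ≠ v := by
    rintro rfl
    exact (huv.exists).elim fun _ hh => hh.false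
  refine ⟨hne, ?_⟩
  obtain ⟨k, hlt, h1, h2⟩ := (huv.and (Ioo_mem_nhdsLT
    (max_lt (D.upward _ _ hu) (D.upward _ _ hv)))).exists
  obtain ⟨h1, h3⟩ := max_lt_iff.1 h1
  have hL := fun hh => h.planar.path_of_onLeft h.st (u := v) (v := u) hh
  have hR := fun hh => h.planar.path_of_onRight h.st (u := u) (v := v) hh
  have hc := h.outer v
  have hc' := h.outer u
  have hbwd : ∀ {M}, D.y u ≤ M → D.y v ≤ M → M ≤ k → ¬ D.curve v w M < D.curve u w M :=
    fun h4 h5 h6 h7 => hlt.not_gt (h.planar.lt_of_lt hv hu (fun _ => h2) ⟨h5, (h6.trans h2.le)⟩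
      ⟨h4, h6.trans h2.le⟩ h2.le h2.le h6 h7)
  rcases le_total (D.y v) (D.y u) with hle | hle
  · have : ¬ D.OnRight u := fun huR => by
      have h4 := huR.curve_lt hv hne (D.acyclicDigraph.ne_of_adj hu) ⟨hle, (D.upward _ _ hu).le⟩
      refine hbwd le_rfl hle h1.le ?_
      rwa [D.curve_start u w hu]
    tauto
  · have : ¬ D.OnLeft v := fun hvL => by
      have h4 := hvL.lt_curve hu hne.symm (D.acyclicDigraph.ne_of_adj hv) ⟨hle, (D.upward _ _ hv).le⟩
      refine hbwd hle le_rfl h3.le ?_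
      rwa [D.curve_start v w hv]
    tauto

end UpwardDrawing

/-! ## Straight-line drawings in a lens -/

/-- The height-`h` point of the line through `(x₁, y₁)` and `(x₂, y₂)`. -/
noncomputable def chordAt (x₁ y₁ x₂ y₂ h : ℝ) : ℝ := x₁ + (h - y₁) * ((x₂ - x₁) / (y₂ - y₁))

theorem chordAt_interp (x₁ y₁ x₂ y₂ m h M : ℝ) : chordAt x₁ y₁ x₂ y₂ h * (M - m) =
    chordAt x₁ y₁ x₂ y₂ m * (M - h) + chordAt x₁ y₁ x₂ y₂ M * (h - m) := by
  unfold chordAt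
  ring

theorem chordAt_left (x₁ y₁ x₂ y₂ : ℝ) : chordAt x₁ y₁ x₂ y₂ y₁ = x₁ := by
  simp [chordAt]

theorem chordAt_right {x₁ y₁ x₂ y₂ : ℝ} (h : y₁ < y₂) : chordAt x₁ y₁ x₂ y₂ y₂ = x₂ := by
  have : y₂ - y₁ ≠ 0 := (sub_pos.2 h).ne'
  unfold chordAt
  field_simp
  ring

/-- The parabola `y * (N - y)` exceeds its own chord by exactly `(h - y₁) * (y₂ - h)`, hence the
strict inequality. -/
theorem chordAt_mem_lens {N x₁ y₁ x₂ y₂ h : ℝ} (h₁ : |x₁| ≤ y₁ * (N - y₁))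
    (h₂ : |x₂| ≤ y₂ * (N - y₂)) (hl : y₁ < h) (hr : h < y₂) :
    |chordAt x₁ y₁ x₂ y₂ h| < h * (N - h) := by
  have hpos : 0 < y₂ - y₁ := by linarith
  have hlr : 0 < (h - y₁) * (y₂ - h) := mul_pos (by linarith) (by linarith)
  have key := chordAt_interp x₁ y₁ x₂ y₂ y₁ h y₂
  rw [chordAt_left, chordAt_right (hl.trans hr)] at key
  rw [abs_le] at h₁ h₂
  have e1 := mul_le_mul_of_nonneg_right h₁.1 (sub_pos.2 hr).le
  have e2 := mul_le_mul_of_nonneg_right h₁.2 (sub_pos.2 hr).le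
  have e3 := mul_le_mul_of_nonneg_right h₂.1 (sub_pos.2 hl).le
  have e4 := mul_le_mul_of_nonneg_right h₂.2 (sub_pos.2 hl).le
  have e5 : h * (N - h) * (y₂ - y₁) = y₁ * (N - y₁) * (y₂ - h) + y₂ * (N - y₂) * (h - y₁) +
      (h - y₁) * (y₂ - h) * (y₂ - y₁) := by ring
  have e6 := mul_pos hlr hpos
  rw [abs_lt]
  constructor
  · refine lt_of_mul_lt_mul_right ?_ hpos.le
    linarith
  · refine lt_of_mul_lt_mul_right ?_ hpos.le
    linarith

open Classical in
/-- The abscissa of a vertex on the lens: on the left arc for the vertices in `L`, on the right arc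
for the others. -/
noncomputable def lensX {V : Type*} (L : V → Prop) (σ : V → ℕ) (v : V) : ℝ :=
  if L v then -(σ v * (Nat.card V - σ v)) else σ v * (Nat.card V - σ v)

theorem lensX_of_left {V : Type*} {L : V → Prop} (σ : V → ℕ) {v : V} (h : L v) :
    lensX L σ v = -(σ v * (Nat.card V - σ v)) := if_pos h

theorem lensX_of_not_left {V : Type*} {L : V → Prop} (σ : V → ℕ) {v : V} (h : ¬ L v) :
    lensX L σ v = σ v * (Nat.card V - σ v) := if_neg h

theorem abs_lensX_le {V : Type*} {G : Digraph V} {σ : V → ℕ} (hσ : LinExt G σ) (L : V → Prop)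
    (v : V) : |lensX L σ v| ≤ σ v * (Nat.card V - σ v) := by
  have h : (σ v : ℝ) ≤ Nat.card V := by exact_mod_cast (hσ.lt v).le
  have h' : (0 : ℝ) ≤ σ v * (Nat.card V - σ v) := mul_nonneg (Nat.cast_nonneg _) (by linarith)
  unfold lensX
  split_ifs
  · rw [abs_neg, abs_of_nonneg h']
  · rw [abs_of_nonneg h']

theorem lens_lt_chordAt {V : Type*} {G : Digraph V} {σ : V → ℕ} (hσ : LinExt G σ)
    {L : V → Prop} {a b w : V} (hw : L w) (ha : σ a < σ w) (hb : σ w < σ b) :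
    lensX L σ w < chordAt (lensX L σ a) (σ a) (lensX L σ b) (σ b) (σ w) := by
  have := chordAt_mem_lens (abs_lensX_le hσ L a) (abs_lensX_le hσ L b)
    (Nat.cast_lt.2 ha) (Nat.cast_lt.2 hb)
  rw [lensX_of_left σ hw]
  exact (abs_lt.1 this).1

theorem chordAt_lt_lens {V : Type*} {G : Digraph V} {σ : V → ℕ} (hσ : LinExt G σ)
    {L : V → Prop} {a b w : V} (hw : ¬ L w) (ha : σ a < σ w) (hb : σ w < σ b) :
    chordAt (lensX L σ a) (σ a) (lensX L σ b) (σ b) (σ w) < lensX L σ w := by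
  have := chordAt_mem_lens (abs_lensX_le hσ L a) (abs_lensX_le hσ L b)
    (Nat.cast_lt.2 ha) (Nat.cast_lt.2 hb)
  rw [lensX_of_not_left σ hw]
  exact (abs_lt.1 this).2

namespace UpwardDrawing

/-- The straight-line drawing of a digraph with the vertices on the boundary of a lens, at the
heights given by a linear extension. -/
noncomputable def lens {V : Type*} {H : Digraph V} {σ : V → ℕ} (hσ : LinExt H σ) (L : V → Prop) :
    UpwardDrawing H where
  x := lensX L σ
  y v := σ v
  curve u v := chordAt (lensX L σ u) (σ u) (lensX L σ v) (σ v)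
  distinct u v h := hσ.inj (Nat.cast_injective (Prod.mk.inj h).2)
  upward u v h := Nat.cast_lt.2 (hσ.mono u v h)
  cont u v h := by
    unfold chordAt
    fun_prop
  curve_start u v h := chordAt_left _ _ _ _
  curve_end u v h := chordAt_right (Nat.cast_lt.2 (hσ.mono u v h))
  avoids u v h w hu hv hw := by
    have h1 : σ u < σ w := lt_of_le_of_ne (by exact_mod_cast hw.1) fun e => hu (hσ.inj e).symm
    have h2 : σ w < σ v := lt_of_le_of_ne (by exact_mod_cast hw.2) fun e => hv (hσ.inj e)
    by_cases hL : L w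
    · exact (lens_lt_chordAt hσ hL h1 h2).ne'
    · exact (chordAt_lt_lens hσ hL h1 h2).ne

section

variable {V : Type*} {G H : Digraph V} {σ : V → ℕ} {L R : V → Prop}

theorem lens_lt_of_ends (hσ : LinExt H σ) {a b c d : V} {m h M : ℝ} (hm : m < h) (hM : h < M)
    (h₁ : (lens hσ L).curve a b m ≤ (lens hσ L).curve c d m)
    (h₂ : (lens hσ L).curve a b M ≤ (lens hσ L).curve c d M)
    (hne : (lens hσ L).curve a b m < (lens hσ L).curve c d m ∨
      (lens hσ L).curve a b M < (lens hσ L).curve c d M) :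
    (lens hσ L).curve a b h < (lens hσ L).curve c d h := by
  have e1 : (lens hσ L).curve a b h * (M - m) = (lens hσ L).curve a b m * (M - h) +
    (lens hσ L).curve a b M * (h - m) := chordAt_interp _ _ _ _ _ _ _
  have e2 : (lens hσ L).curve c d h * (M - m) = (lens hσ L).curve c d m * (M - h) +
    (lens hσ L).curve c d M * (h - m) := chordAt_interp _ _ _ _ _ _ _
  have h3 := mul_le_mul_of_nonneg_right h₁ (sub_pos.2 hM).le
  have h4 := mul_le_mul_of_nonneg_right h₂ (sub_pos.2 hm).le
  refine lt_of_mul_lt_mul_right ?_ (show 0 ≤ M - m by linarith)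
  rw [e1, e2]
  rcases hne with hne | hne
  · have h5 := mul_lt_mul_of_pos_right hne (sub_pos.2 hM)
    linarith
  · have h5 := mul_lt_mul_of_pos_right hne (sub_pos.2 hm)
    linarith

/-- The higher tail is a point of an arc which the other edge passes as a chord. A right vertex
inside an edge of `G` is not on the left side too, so it really lies on the right arc. -/
theorem lens_lt_of_tailLeft (h : TwoSided G L R) (hG : LinExt G σ) (hσ : LinExt H σ)
    {a b c d : V} (hab : G.Adj a b) (hcd : G.Adj c d) (hGH : G ≤ H) (htail : TailLeft G L R a c)
    (had : σ a < σ d) (hcb : σ c < σ b) :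
    (lens hσ L).curve a b (max (σ a) (σ c)) < (lens hσ L).curve c d (max (σ a) (σ c)) := by
  obtain ⟨hac, htail⟩ := htail
  rcases lt_or_ge (σ c) (σ a) with hlt | hge
  · have h1 := hG.not_path hlt
    rw [max_eq_left (by exact_mod_cast hlt.le)]
    refine lt_of_eq_of_lt ((lens hσ L).curve_start a b (hGH hab))
      (lens_lt_chordAt hσ (by tauto) hlt had)
  · have hlt := lt_of_le_of_ne hge fun e => hac (hG.inj e)
    have h1 := hG.not_path hlt
    rw [max_eq_right (by exact_mod_cast hge)]
    refine lt_of_lt_of_eq (chordAt_lt_lens hσ (fun hL => ?_) hlt hcb)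
      ((lens hσ L).curve_start c d (hGH hcd)).symm
    exact h.not_both_inside hG hab hlt hcb hL (by tauto)

theorem lens_lt_of_headLeft (h : TwoSided G L R) (hG : LinExt G σ) (hσ : LinExt H σ)
    {a b c d : V} (hab : G.Adj a b) (hcd : G.Adj c d) (hGH : G ≤ H) (hhead : HeadLeft G L R b d)
    (had : σ a < σ d) (hcb : σ c < σ b) :
    (lens hσ L).curve a b (min (σ b) (σ d)) < (lens hσ L).curve c d (min (σ b) (σ d)) := by
  obtain ⟨hbd, hhead⟩ := hhead
  rcases lt_or_ge (σ b) (σ d) with hlt | hge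
  · have h1 := hG.not_path hlt
    rw [min_eq_left (by exact_mod_cast hlt.le)]
    refine lt_of_eq_of_lt ((lens hσ L).curve_end a b (hGH hab))
      (lens_lt_chordAt hσ (by tauto) hcb hlt)
  · have hlt := lt_of_le_of_ne hge fun e => hbd (hG.inj e).symm
    have h1 := hG.not_path hlt
    rw [min_eq_right (by exact_mod_cast hge)]
    refine lt_of_lt_of_eq (chordAt_lt_lens hσ (fun hL => ?_) had hlt)
      ((lens hσ L).curve_end c d (hGH hcd)).symm
    exact h.not_both_inside hG hab had hlt hL (by tauto)

theorem lens_lt (h : TwoSided G L R) (hG : LinExt G σ) (hσ : LinExt H σ)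
    {a b c d : V} (hab : G.Adj a b) (hcd : G.Adj c d) (hGH : G ≤ H)
    (htail : a = c ∨ TailLeft G L R a c) (hhead : b = d ∨ HeadLeft G L R b d)
    (hne : ¬ (a = c ∧ b = d)) {k : ℝ} (h₁ : k ∈ Ioo (σ a : ℝ) (σ b))
    (h₂ : k ∈ Ioo (σ c : ℝ) (σ d)) :
    (lens hσ L).curve a b k < (lens hσ L).curve c d k := by
  have had : σ a < σ d := by exact_mod_cast h₁.1.trans h₂.2
  have hcb : σ c < σ b := by exact_mod_cast h₂.1.trans h₁.2
  have htail' := fun ht => lens_lt_of_tailLeft h hG hσ hab hcd hGH ht had hcb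
  have hhead' := fun hh => lens_lt_of_headLeft h hG hσ hab hcd hGH hh had hcb
  refine lens_lt_of_ends hσ (max_lt h₁.1 h₂.1) (lt_min h₁.2 h₂.2) ?_ ?_ ?_
  · rcases htail with rfl | ht
    · rw [max_self]
      exact (((lens hσ L).curve_start a b (hGH hab)).trans
        ((lens hσ L).curve_start a d (hGH hcd)).symm).le
    · exact (htail' ht).le
  · rcases hhead with rfl | hh
    · rw [min_self]
      exact (((lens hσ L).curve_end a b (hGH hab)).trans
        ((lens hσ L).curve_end c b (hGH hcd)).symm).le
    · exact (hhead' hh).le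
  · rcases htail with rfl | ht
    · rcases hhead with rfl | hh
      · exact absurd ⟨rfl, rfl⟩ hne
      · exact .inr (hhead' hh)
    · exact .inl (htail' ht)

/-- Edges with tails and heads in the same order are separated by linear interpolation; opposite
orders contradict `TwoSided.noncrossing`. -/
theorem lens_restrict_isPlanar (h : TwoSided G L R) (hG : LinExt G σ) (hσ : LinExt H σ)
    (hGH : G ≤ H) : ((lens hσ L).restrict hGH).IsPlanar := by
  refine Set.eq_empty_iff_forall_notMem.2 ?_
  rintro ⟨z, k⟩ ⟨⟨a, b⟩, ⟨c, d⟩, hab, hcd, hne, -, h₁, h₂, heq⟩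
  simp only at hab hcd heq
  replace h₁ : k ∈ Ioo (σ a : ℝ) (σ b) := h₁
  replace h₂ : k ∈ Ioo (σ c : ℝ) (σ d) := h₂
  have hne' : ¬ (a = c ∧ b = d) := fun e => hne (Prod.ext e.1 e.2)
  have hbc : ¬ DirectedPath G b c := hG.not_path (by exact_mod_cast h₂.1.trans h₁.2)
  have hda : ¬ DirectedPath G d a := hG.not_path (by exact_mod_cast h₁.1.trans h₂.2)
  have hlt := fun ht hh => (lens_lt h hG hσ hab hcd hGH ht hh hne' h₁ h₂).ne heq
  have hgt := fun ht hh => (lens_lt h hG hσ hcd hab hGH ht hh (fun e => hne' ⟨e.1.symm, e.2.symm⟩)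
    h₂ h₁).ne' heq
  by_cases hac : a = c
  · rcases h.headLeft_total (fun hbd : b = d => hne' ⟨hac, hbd⟩) with h1 | h1
    · exact hlt (.inl hac) (.inr h1)
    · exact hgt (.inl hac.symm) (.inr h1)
  by_cases hbd : b = d
  · rcases h.tailLeft_total hac with h1 | h1
    · exact hlt (.inr h1) (.inl hbd)
    · exact hgt (.inr h1) (.inl hbd.symm)
  rcases h.tailLeft_total hac with h1 | h1 <;> rcases h.headLeft_total hbd with h2 | h2
  · exact hlt (.inr h1) (.inr h2)
  · exact h.noncrossing a b c d hab hcd h1 h2 hbc hda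
  · exact h.noncrossing c d a b hcd hab h1 h2 hda hbc
  · exact hgt (.inr h1) (.inr h2)

theorem lens_sameEmbedding [Finite V] {D : UpwardDrawing G} {s t : V} (h : D.IsOuterplanarST s t)
    (hG : LinExt G σ) (hσ : LinExt H σ) (hGH : G ≤ H) :
    D.SameEmbedding ((lens hσ D.OnLeft).restrict hGH) := by
  set D' := (lens hσ D.OnLeft).restrict hGH with hD'
  have hout : ∀ {u v w}, G.Adj u v → G.Adj u w → D.OutLeft u v w → D'.OutLeft u v w := by
    intro u v w hv hw hvw
    have hh := h.headLeft_of_outLeft hv hw hvw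
    have hmem := Ioo_mem_nhdsGT (lt_min (D'.upward u v hv) (D'.upward u w hw))
    filter_upwards [hmem] with k hk
    exact lens_lt h.twoSided hG hσ hv hw hGH (.inl rfl) (.inr hh) (fun e => hh.1 e.2)
      ⟨hk.1, hk.2.trans_le (min_le_left _ _)⟩ ⟨hk.1, hk.2.trans_le (min_le_right _ _)⟩
  have hin : ∀ {u v w}, G.Adj u w → G.Adj v w → D.InLeft u v w → D'.InLeft u v w := by
    intro u v w hv hw hvw
    have hh := h.tailLeft_of_inLeft hv hw hvw
    have hmem := Ioo_mem_nhdsLT (max_lt (D'.upward u w hv) (D'.upward v w hw))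
    filter_upwards [hmem] with k hk
    exact lens_lt h.twoSided hG hσ hv hw hGH (.inr hh) (.inl rfl) (fun e => hh.1 e.1)
      ⟨(le_max_left _ _).trans_lt hk.1, hk.2⟩ ⟨(le_max_right _ _).trans_lt hk.1, hk.2⟩
  refine ⟨fun u v w hv hw => ⟨hout hv hw, fun h' => ?_⟩,
    fun u v w hu hv => ⟨hin hu hv, fun h' => ?_⟩⟩
  · by_cases e : v = w
    · subst e
      obtain ⟨k, hk⟩ := h'.exists
      exact absurd hk (lt_irrefl _)
    · refine (h.planar.outLeft_total hv hw e).resolve_right fun hn => ?_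
      obtain ⟨k, hk, hk'⟩ := (h'.and (hout hw hv hn)).exists
      exact hk.not_gt hk'
  · by_cases e : u = v
    · subst e
      obtain ⟨k, hk⟩ := h'.exists
      exact absurd hk (lt_irrefl _)
    · refine (h.planar.inLeft_total hu hv e).resolve_right fun hn => ?_
      obtain ⟨k, hk, hk'⟩ := (h'.and (hin hv hu hn)).exists
      exact hk.not_gt hk'

/-- In a lens, an edge between consecutive vertices meets only the edges around both of them, and
only if the two vertices are on different sides. -/
theorem mem_switchesAround_of_meet (h : TwoSided G L R) (hG : LinExt G σ) (hσ : LinExt H σ)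
    (hGH : G ≤ H) {u v a b : V} (huv : H.Adj u v) (hsucc : σ v = σ u + 1) (hnew : ¬ G.Adj u v)
    (hab : G.Adj a b) {k : ℝ} (hk : k ∈ (lens hσ L).meetHeights (u, v) (a, b)) :
    (u, v) ∈ switchesAround L R σ a b := by
  obtain ⟨⟨h1, h2⟩, ⟨h3, h4⟩, h5⟩ := hk
  change (σ u : ℝ) < k at h1
  change k < (σ v : ℝ) at h2
  change (σ a : ℝ) < k at h3
  change k < (σ b : ℝ) at h4
  change (lens hσ L).curve u v k = (lens hσ L).curve a b k at h5
  have hav : σ a < σ v := by exact_mod_cast h3.trans h2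
  have hub : σ u < σ b := by exact_mod_cast h1.trans h4
  have hu : (lens hσ L).curve u v (σ u) = lensX L σ u := (lens hσ L).curve_start u v huv
  have hv : (lens hσ L).curve u v (σ v) = lensX L σ v := (lens hσ L).curve_end u v huv
  have ha : (lens hσ L).curve a b (σ a) = lensX L σ a := (lens hσ L).curve_start a b (hGH hab)
  have hb : (lens hσ L).curve a b (σ b) = lensX L σ b := (lens hσ L).curve_end a b (hGH hab)
  have hlt := fun e1 e2 e3 => (lens_lt_of_ends (L := L) hσ (a := u) (b := v) (c := a) (d := b)
    h1 h2 e1 e2 e3).ne h5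
  have hgt := fun e1 e2 e3 => (lens_lt_of_ends (L := L) hσ (a := a) (b := b) (c := u) (d := v)
    h1 h2 e1 e2 e3).ne' h5
  rw [hu, hv] at hlt hgt
  by_cases hau : σ a < σ u
  · by_cases hvb : σ v < σ b
    · refine ⟨⟨hsucc, fun hL => ?_, fun hR => ?_⟩, hau, hvb⟩
      · have e1 := lens_lt_chordAt hσ hL.1 hau hub
        have e2 := lens_lt_chordAt hσ hL.2 hav hvb
        exact hlt e1.le e2.le (.inl e1)
      · have e1 := chordAt_lt_lens hσ (L := L)
          (fun hL => h.not_both_inside hG hab hau hub hL hR.1) hau hub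
        have e2 := chordAt_lt_lens hσ (L := L)
          (fun hL => h.not_both_inside hG hab hav hvb hL hR.2) hav hvb
        exact hgt e1.le e2.le (.inl e1)
    -- Segments with a common end separate at once: the other end of the short one is on an arc,
    -- strictly beside the chord.
    · obtain rfl : v = b := hσ.inj (by omega)
      rw [hb] at hlt hgt
      by_cases hL : L u
      · have e1 := lens_lt_chordAt hσ hL hau hub
        exact absurd (hlt e1.le le_rfl (.inl e1)) id
      · have e1 := chordAt_lt_lens hσ hL hau hub
        exact absurd (hgt e1.le le_rfl (.inl e1)) id
  · obtain rfl : u = a := hσ.inj (by omega)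
    rw [ha] at hlt hgt
    have hvb : σ v < σ b := by
      have : σ v ≠ σ b := fun e => hnew (hσ.inj e ▸ hab)
      omega
    by_cases hL : L v
    · have e1 := lens_lt_chordAt hσ hL hav hvb
      exact absurd (hlt le_rfl e1.le (.inr e1)) id
    · have e1 := chordAt_lt_lens hσ hL hav hvb
      exact absurd (hgt le_rfl e1.le (.inr e1)) id

/-- Two lines that meet twice coincide, but the chord `(a, b)` misses the arc point of `u`. -/
theorem meetHeights_subsingleton (hσ : LinExt H σ) {u v a b : V} (huv : H.Adj u v)
    (hau : σ a < σ u) (hub : σ u < σ b) :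
    ((lens hσ L).meetHeights (u, v) (a, b)).Subsingleton := by
  have key : ∀ k ∈ (lens hσ L).meetHeights (u, v) (a, b),
      ∀ k' ∈ (lens hσ L).meetHeights (u, v) (a, b), ¬ k < k' := by
    rintro k ⟨-, -, h2⟩ k' ⟨-, -, h4⟩ hlt
    change (lens hσ L).curve u v k = (lens hσ L).curve a b k at h2
    change (lens hσ L).curve u v k' = (lens hσ L).curve a b k' at h4
    have e1 : (lens hσ L).curve a b k * (k' - σ u) = (lens hσ L).curve a b (σ u) * (k' - k) +
      (lens hσ L).curve a b k' * (k - σ u) := chordAt_interp _ _ _ _ _ _ _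
    have e2 : (lens hσ L).curve u v k * (k' - σ u) = (lens hσ L).curve u v (σ u) * (k' - k) +
      (lens hσ L).curve u v k' * (k - σ u) := chordAt_interp _ _ _ _ _ _ _
    have hu : (lens hσ L).curve u v (σ u) = lensX L σ u := (lens hσ L).curve_start u v huv
    rw [h2, h4, e1, hu] at e2
    have e3 : (lens hσ L).curve a b (σ u) = lensX L σ u :=
      mul_right_cancel₀ (sub_pos.2 hlt).ne' (add_right_cancel e2)
    by_cases hL : L u
    · exact (lens_lt_chordAt hσ hL hau hub).ne' e3
    · exact (chordAt_lt_lens hσ hL hau hub).ne e3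
  intro k hk k' hk'
  exact le_antisymm (not_lt.1 (key k' hk' k hk)) (not_lt.1 (key k hk k' hk'))

theorem meetHeights_comm (D : UpwardDrawing G) (e f : V × V) :
    D.meetHeights e f = D.meetHeights f e := by
  ext k
  exact ⟨fun h => ⟨h.2.1, h.1, h.2.2.symm⟩, fun h => ⟨h.2.1, h.1, h.2.2.symm⟩⟩

end

end UpwardDrawing

/-! ## The completion set of a linear extension -/

/-- The pairs of consecutive vertices which are not edges. -/
def newEdges {V : Type*} (G : Digraph V) (σ : V → ℕ) : Set (V × V) :=
  {p | σ p.2 = σ p.1 + 1 ∧ ¬ G.Adj p.1 p.2}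

section

variable {V : Type*} {G : Digraph V} {σ : V → ℕ} {L R : V → Prop}

theorem LinExt.sup_newEdges (hσ : LinExt G σ) : LinExt (G ⊔ edgesDigraph (newEdges G σ)) σ where
  inj := hσ.inj
  mono u v h := by
    rcases h with h | h
    · exact hσ.mono u v h
    · have := h.1
      simp only at this
      omega
  lt := hσ.lt

theorem LinExt.isAcyclicHPCompletion [Finite V] (hσ : LinExt G σ) {s t : V}
    (hs : ∀ v, DirectedPath G s v) (ht : ∀ v, DirectedPath G v t) :
    IsAcyclicHPCompletion G s t (newEdges G σ) := by
  -- Acyclicity follows from the existence of an upward drawing; the choice of sides is immaterial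
  -- here.
  refine ⟨fun u v h => h.2, (UpwardDrawing.lens hσ.sup_newEdges fun _ => True).acyclicDigraph, ?_⟩
  have hex := fun i => hσ.exists_eq (i := i)
  have : Nonempty V := ⟨s⟩
  choose! g hg using hex
  have hgσ : ∀ v, g (σ v) = v := fun v => hσ.inj (hg _ (hσ.lt v))
  have hpos : 0 < Nat.card V := Nat.card_pos
  have hs0 : g 0 = s := hσ.inj (le_antisymm (hσ.le (hs _) |>.trans' (by rw [hg 0 hpos]; omega))
    (hσ.le (hs _)) |>.symm ▸ rfl)
  have htn : g (Nat.card V - 1) = t := by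
    refine hσ.inj (le_antisymm (hσ.le (ht _)) ?_)
    rw [hg _ (by omega)]
    have := hσ.lt t
    omega
  refine ⟨(List.range (Nat.card V)).map g, ⟨?_, ?_, ?_, ?_, ?_⟩, ?_⟩
  · rw [List.isChain_map, List.isChain_range]
    intro m hm
    by_cases h : G.Adj (g m) (g (m + 1))
    · exact .inl h
    · refine .inr ⟨?_, h⟩
      simp only
      rw [hg m (by omega), hg (m + 1) (by omega)]
  · refine List.Nodup.map_on (fun i hi j hj hij => ?_) List.nodup_range
    rw [← hg i (List.mem_range.1 hi), ← hg j (List.mem_range.1 hj), hij]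
  · exact fun v => List.mem_map.2 ⟨σ v, List.mem_range.2 (hσ.lt v), hgσ v⟩
  · rw [List.head?_map, List.head?_range, if_neg hpos.ne', Option.map_some, hs0]
  · rw [List.getLast?_map, List.getLast?_range, if_neg hpos.ne', Option.map_some, htn]
  · intro u v huv
    have h1 : σ v = σ u + 1 := huv.1
    have h2 := hσ.lt v
    have h3 : [u, v] = [σ u, σ u + 1].map g := by simp [hgσ, ← h1]
    rw [h3]
    refine List.IsInfix.map g ⟨List.range (σ u), List.range' (σ u + 2) (Nat.card V - (σ u + 2)), ?_⟩
    have h4 : [σ u, σ u + 1] = List.range' (σ u) 2 := rfl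
    rw [List.range_eq_range', List.range_eq_range', h4]
    have h5 := List.range'_append_1 (s := 0) (m := σ u) (n := 2)
    rw [zero_add] at h5
    have h6 := List.range'_append_1 (s := 0) (m := σ u + 2) (n := Nat.card V - (σ u + 2))
    rw [zero_add] at h6
    rw [h5, h6, Nat.add_sub_cancel' (by omega)]

/-- Edges of `G` do not cross each other, and distinct new edges occupy disjoint height ranges. A
new edge meets an edge of `G` only in a forced crossing, and at most once. -/
theorem TwoSided.encard_lens_crossings_le (h : TwoSided G L R) (hσ : LinExt G σ) :
    (UpwardDrawing.lens hσ.sup_newEdges L).crossings.encard ≤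
      (forcedCrossings G L R σ).encard := by
  set D := UpwardDrawing.lens hσ.sup_newEdges L with hD
  have hle : G ≤ G ⊔ edgesDigraph (newEdges G σ) := le_sup_left
  have hmixed : ∀ e f : V × V, e ∈ newEdges G σ → G.Adj f.1 f.2 → ∀ k ∈ D.meetHeights e f,
      (e, f) ∈ forcedCrossings G L R σ := by
    rintro ⟨u, v⟩ ⟨a, b⟩ he hf k hk
    obtain ⟨h1, h2, h3⟩ := UpwardDrawing.mem_switchesAround_of_meet h hσ hσ.sup_newEdges hle
      (.inr he) he.1 he.2 hf hk
    exact ⟨h1, hf, h2, h3⟩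
  have hex : ∀ c ∈ D.crossings, ∃ x ∈ forcedCrossings G L R σ, x.1 ∈ newEdges G σ ∧
      c.1 = s(x.1, x.2) ∧ c.2 ∈ D.meetHeights x.1 x.2 := by
    rintro ⟨z, k⟩ ⟨e, f, he, hf, hne, hz, hk⟩
    simp only at hz hk
    rcases he with he | he <;> rcases hf with hf | hf
    · have : (z, k) ∈ (D.restrict hle).crossings := ⟨e, f, he, hf, hne, hz, hk⟩
      rw [UpwardDrawing.lens_restrict_isPlanar h hσ hσ.sup_newEdges hle] at this
      exact absurd this (Set.notMem_empty _)
    · rw [UpwardDrawing.meetHeights_comm] at hk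
      exact ⟨(f, e), hmixed f e hf he k hk, hf, by rw [hz, Sym2.eq_swap], hk⟩
    · exact ⟨(e, f), hmixed e f he hf k hk, he, hz, hk⟩
    · exfalso
      obtain ⟨⟨h1, h2⟩, ⟨h3, h4⟩, -⟩ := hk
      change (σ e.1 : ℝ) < k at h1
      change k < (σ e.2 : ℝ) at h2
      change (σ f.1 : ℝ) < k at h3
      change k < (σ f.2 : ℝ) at h4
      have h5 : σ e.1 < σ f.2 := by exact_mod_cast h1.trans h4
      have h6 : σ f.1 < σ e.2 := by exact_mod_cast h3.trans h2
      have h7 : σ e.2 = σ e.1 + 1 := he.1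
      have h8 : σ f.2 = σ f.1 + 1 := hf.1
      exact hne (Prod.ext (hσ.inj (by omega)) (hσ.inj (by omega)))
  rcases D.crossings.eq_empty_or_nonempty with h0 | ⟨-, e, -⟩
  · simp [h0]
  have : Nonempty V := ⟨e.1⟩
  choose! F hF hF1 hF2 hF3 using hex
  refine Set.encard_le_encard_of_injOn (f := F) (fun c hc => hF c hc) fun c hc c' hc' heq => ?_
  refine Prod.ext ((hF2 c hc).trans (heq ▸ (hF2 c' hc').symm)) ?_
  have h1 := hF3 c hc
  have h2 := hF3 c' hc'
  rw [← heq] at h2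
  obtain ⟨⟨hs, -⟩, -, h3, h4⟩ := hF c hc
  have h5 : σ (F c).1.1 < σ (F c).2.2 := (Nat.lt_succ_self _).trans_eq hs.symm |>.trans h4
  exact UpwardDrawing.meetHeights_subsingleton (a := (F c).2.1) (b := (F c).2.2)
    hσ.sup_newEdges (.inr (hF1 c hc)) h3 h5 h1 h2

/-! ## The lower bound -/

/-- Every drawing of an acyclic HP-completion has all the crossings which its hamiltonian path
forces. -/
theorem UpwardDrawing.exists_linExt_forcedCrossings_le [Finite V] {D : UpwardDrawing G} {s t : V}
    (hG : D.IsOuterplanarST s t) {Q : Set (V × V)} (D' : UpwardDrawing (G ⊔ edgesDigraph Q))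
    (hQ : IsAcyclicHPCompletion G s t Q) (hD' : D'.Preserves le_sup_left D) :
    ∃ σ, LinExt G σ ∧
      (forcedCrossings G D.OnLeft D.OnRight σ).encard ≤ D'.crossings.encard := by
  classical
  have := Fintype.ofFinite V
  obtain ⟨l, hl, -⟩ := hQ.ham
  have hget : ∀ v, ∃ h : l.idxOf v < l.length, l[l.idxOf v] = v := fun v =>
    ⟨List.idxOf_lt_length_iff.2 (hl.all v), List.getElem_idxOf _⟩
  -- Heights increase along the hamiltonian path, so positions on it order all vertices by height.
  have hlt : ∀ {u v}, l.idxOf u < l.idxOf v → D'.y u < D'.y v := by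
    have hpw : l.Pairwise fun u v => D'.y u < D'.y v :=
      haveI : IsTrans V fun u v => D'.y u < D'.y v := ⟨fun _ _ _ h h' => lt_trans h h'⟩
      (hl.chain.imp fun u v h => D'.upward u v h).pairwise
    intro u v huv
    obtain ⟨hu, hu'⟩ := hget u
    obtain ⟨hv, hv'⟩ := hget v
    have := List.pairwise_iff_getElem.1 hpw _ _ hu hv huv
    rwa [hu', hv'] at this
  have hσ : LinExt G fun v => l.idxOf v := by
    refine ⟨fun u v huv => ?_, fun u v huv => ?_, fun v => ?_⟩
    · obtain ⟨hu, hu'⟩ := hget u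
      obtain ⟨hv, hv'⟩ := hget v
      rw [← hu', ← hv']
      simp only [huv]
    · have h1 := D'.upward u v (.inl huv)
      rcases lt_trichotomy (l.idxOf u) (l.idxOf v) with h2 | h2 | h2
      · exact h2
      · obtain ⟨hu, hu'⟩ := hget u
        obtain ⟨hv, hv'⟩ := hget v
        have : u = v := by rw [← hu', ← hv']; simp only [h2]
        exact absurd (this ▸ h1) (lt_irrefl _)
      · exact absurd (hlt h2) h1.not_gt
    · rw [Nat.card_eq_fintype_card]
      exact (hget v).1.trans_le hl.nodup.length_le_card
  refine ⟨_, hσ, ?_⟩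
  have h := hG.twoSided
  have hL := fun {v} => hD'.2.onLeft (v := v) hG.planar hD'.1 hG.st
  have hR := fun {v} => hD'.2.onRight (v := v) hG.planar hD'.1 hG.st
  have hex : ∀ x ∈ forcedCrossings G D.OnLeft D.OnRight (fun v => l.idxOf v),
      x.1 ∈ Q ∧ ¬ G.Adj x.1.1 x.1.2 ∧ ∃ k, k ∈ D'.meetHeights x.1 x.2 := by
    rintro ⟨⟨u, v⟩, ⟨a, b⟩⟩ ⟨⟨hsucc, hsw⟩, hab, hau, hvb⟩
    simp only at hsucc hsw hab hau hvb
    have hnot : ¬ G.Adj u v := by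
      rcases hsw.cases h with h1 | h1
      · exact (h.not_adj_inside hσ hab h1.1 h1.2 hau (by omega) (by omega) hvb).1
      · exact (h.not_adj_inside hσ hab h1.2 h1.1 (by omega) hvb hau (by omega)).2
    have hadj : (G ⊔ edgesDigraph Q).Adj u v := by
      obtain ⟨hu, hu'⟩ := hget u
      obtain ⟨hv, hv'⟩ := hget v
      have := List.isChain_iff_getElem.1 hl.chain (l.idxOf u) (hsucc ▸ hv)
      simp only [← hsucc] at this
      rwa [hu', hv'] at this
    refine ⟨hadj.resolve_left hnot, hnot, ?_⟩
    have hyau := hlt hau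
    have hyuv := D'.upward u v hadj
    have hyvb := hlt hvb
    have hne : ∀ {w}, l.idxOf a < l.idxOf w → w ≠ a := fun h e => by simp [e] at h
    have hne' : ∀ {w}, l.idxOf w < l.idxOf b → w ≠ b := fun h e => by simp [e] at h
    have hau' := hne hau
    have hav' : v ≠ a := hne (by omega)
    have hub' : u ≠ b := hne' (by omega)
    have hvb' := hne' hvb
    have hmu : D'.y u ∈ Icc (D'.y a) (D'.y b) := ⟨hyau.le, (hyuv.trans hyvb).le⟩
    have hmv : D'.y v ∈ Icc (D'.y a) (D'.y b) := ⟨(hyau.trans hyuv).le, hyvb.le⟩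
    have hc1 := D'.cont u v hadj
    have hc2 : ContinuousOn (D'.curve a b) (Icc (D'.y u) (D'.y v)) :=
      (D'.cont a b (.inl hab)).mono (Icc_subset_Icc hyau.le hyvb.le)
    have hs := D'.curve_start u v hadj
    have he := D'.curve_end u v hadj
    -- The vertices `u` and `v` lie on different sides of the curve of `(a, b)`.
    have hfin : ∃ k ∈ Ioo (D'.y u) (D'.y v), D'.curve u v k - D'.curve a b k = 0 := by
      rcases hsw.cases h with ⟨h1, h2⟩ | ⟨h1, h2⟩
      · have e1 : D'.x u < D'.curve a b (D'.y u) := (hL h1).lt_curve hab hau' hub' hmu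
        have e2 : D'.curve a b (D'.y v) < D'.x v := (hR h2).curve_lt hab hav' hvb' hmv
        exact intermediate_value_Ioo hyuv.le (hc1.sub hc2)
          ⟨by rw [Pi.sub_apply]; linarith, by rw [Pi.sub_apply]; linarith⟩
      · have e1 : D'.curve a b (D'.y u) < D'.x u := (hR h1).curve_lt hab hau' hub' hmu
        have e2 : D'.x v < D'.curve a b (D'.y v) := (hL h2).lt_curve hab hav' hvb' hmv
        exact intermediate_value_Ioo' hyuv.le (hc1.sub hc2)
          ⟨by rw [Pi.sub_apply]; linarith, by rw [Pi.sub_apply]; linarith⟩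
    obtain ⟨k, hk, hk0⟩ := hfin
    exact ⟨k, hk, ⟨hyau.trans hk.1, hk.2.trans hyvb⟩, sub_eq_zero.1 hk0⟩
  choose! hQ' hnot k hk using hex
  -- The unordered pair determines the ordered one, since only its second member is an edge of `G`.
  refine Set.encard_le_encard_of_injOn (f := fun x => (s(x.1, x.2), k x)) ?_ ?_
  · intro x hx
    exact ⟨x.1, x.2, .inr (hQ' x hx), .inl hx.2.1, fun e => hnot x hx (e ▸ hx.2.1), rfl, hk x hx⟩
  · intro x hx x' hx' heq
    rcases Sym2.eq_iff.1 (Prod.mk.inj heq).1 with h1 | h1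
    · exact Prod.ext h1.1 h1.2
    · exact absurd (h1.1 ▸ hx'.2.1) (hnot x hx)

end

/-! ## `st`-polygons -/

theorem DirectedPath.of_induced {V : Type*} {G : Digraph V} {S : Set V} {u v : S}
    (h : DirectedPath (inducedDigraph G S) u v) : DirectedPath G u v :=
  Relation.ReflTransGen.lift Subtype.val (fun _ _ h => h) _ _ h

/-- The side of an `st`-polygon which contains `p` either contains a vertex `u` of the same side
of the digraph, or has an edge around `u`. -/
theorem mem_or_exists_edge_around {V : Type*} {G : Digraph V} (hG : AcyclicDigraph G)
    {L : V → Prop} (hchain : ∀ u v, L u → L v → DirectedPath G u v ∨ DirectedPath G v u)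
    {S : Set V} {a d p : S} {Z : S → Prop} (hZ : ∀ z, Z z → L z) (hp : Z p)
    (hsucc : ∀ z w : S, Z z → G.Adj z w → Z w ∨ w = d)
    (hpred : ∀ z w : S, Z w → G.Adj z w → Z z ∨ z = a)
    (hap : DirectedPath (inducedDigraph G S) a p) (hpd : DirectedPath (inducedDigraph G S) p d)
    {u : V} (hu : L u) (hau : StrictlyBetween G a u d) :
    u ∈ S ∨ ∃ z z' : S, G.Adj z z' ∧ DirectedPath G z u ∧ DirectedPath G u z' ∧ u ≠ z ∧ u ≠ z' ∧
      (z = a ∨ Z z) ∧ (z' = d ∨ Z z') := by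
  obtain ⟨h1, h2, h3, h4⟩ := hau
  -- From a side vertex before `u`, follow the polygon towards `d` until it hits `u` or an edge
  -- jumps over it; `hdown` does the same towards `a`.
  have hup : ∀ z : S, DirectedPath (inducedDigraph G S) z d → Z z → DirectedPath G z u →
      u ∈ S ∨ ∃ z z' : S, G.Adj z z' ∧ DirectedPath G z u ∧ DirectedPath G u z' ∧ u ≠ z ∧ u ≠ z' ∧
        (z = a ∨ Z z) ∧ (z' = d ∨ Z z') := by
    intro z hzd
    induction hzd using Relation.ReflTransGen.head_induction_on with
    | refl => exact fun _ hzu => absurd (hG.antisymm h2 hzu) h4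
    | @head z w hzw hwd ih =>
      intro hz hzu
      by_cases hzu' : u = z
      · exact .inl (hzu' ▸ z.2)
      rcases hsucc z w hz hzw with hw | rfl
      · rcases hchain w u (hZ w hw) hu with h5 | h5
        · exact ih hw h5
        · by_cases h6 : u = w
          · exact .inl (h6 ▸ w.2)
          · exact .inr ⟨z, w, hzw, hzu, h5, hzu', h6, .inr hz, .inr hw⟩
      · exact .inr ⟨z, w, hzw, hzu, h2, hzu', h4, .inr hz, .inl rfl⟩
  have hdown : ∀ z : S, DirectedPath (inducedDigraph G S) a z → Z z → DirectedPath G u z →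
      u ∈ S ∨ ∃ z z' : S, G.Adj z z' ∧ DirectedPath G z u ∧ DirectedPath G u z' ∧ u ≠ z ∧ u ≠ z' ∧
        (z = a ∨ Z z) ∧ (z' = d ∨ Z z') := by
    intro z haz
    induction haz with
    | refl => exact fun _ huz => absurd (hG.antisymm huz h1) h3
    | @tail w z haw hwz ih =>
      intro hz huz
      by_cases hzu' : u = z
      · exact .inl (hzu' ▸ z.2)
      rcases hpred w z hz hwz with hw | rfl
      · rcases hchain u w hu (hZ w hw) with h5 | h5
        · exact ih hw h5
        · by_cases h6 : u = w
          · exact .inl (h6 ▸ w.2)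
          · exact .inr ⟨w, z, hwz, h5, huz, h6, hzu', .inr hw, .inr hz⟩
      · exact .inr ⟨w, z, hwz, h1, huz, h3, hzu', .inl rfl, .inr hz⟩
  rcases hchain p u (hZ p hp) hu with h5 | h5
  · exact hup p hpd hp h5
  · exact hdown p hap hp h5

/-- An edge between the sides, or a vertex on both sides, has no edge of the left side of a polygon
around its left end. -/
theorem TwoSided.no_edge_around {V : Type*} {G : Digraph V} {L R : V → Prop}
    (h : TwoSided G L R) {a d u w z z' : V} (hu : L u) (hw : R w) (haw : StrictlyBetween G a w d)
    (huw : u = w ∨ G.Adj u w ∨ G.Adj w u) (hz : G.Adj z z') (hzu : DirectedPath G z u)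
    (huz : DirectedPath G u z') (hne : u ≠ z) (hne' : u ≠ z') (hza : z = a ∨ (L z ∧ ¬ R z))
    (hzd : z' = d ∨ (L z' ∧ ¬ R z')) : False := by
  obtain ⟨h1, h2, h3, h4⟩ := haw
  rcases huw with rfl | huw | huw
  · exact h.not_spanned z z' u hz hzu huz hne hne' hu hw
  · refine h.noncrossing u w z z' huw hz ⟨hne, .inl ⟨hu, hzu⟩⟩ ?_ (fun hh => ?_) (fun hh => ?_)
    · rcases hzd with rfl | ⟨hL, hR⟩
      · exact ⟨h4.symm, .inr (.inl ⟨hw, h2⟩)⟩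
      · exact ⟨fun e => hR (e ▸ hw), .inr (.inr ⟨hL, hw⟩)⟩
    · exact h.acyclic.not_adj_of_path (hh.trans hzu) huw
    · exact hne' (h.acyclic.antisymm huz hh)
  · refine h.noncrossing z z' w u hz huw ?_ ⟨hne', .inl ⟨hu, huz⟩⟩ (fun hh => ?_) (fun hh => ?_)
    · rcases hza with rfl | ⟨hL, hR⟩
      · exact ⟨h3.symm, .inr (.inl ⟨hw, h1⟩)⟩
      · exact ⟨fun e => hR (e ▸ hw), .inr (.inr ⟨hL, hw⟩)⟩
    · exact h.acyclic.not_adj_of_path (huz.trans hh) huw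
    · exact hne (h.acyclic.antisymm hh hzu)

namespace UpwardDrawing

variable {V : Type*} {G : Digraph V} {D : UpwardDrawing G}

theorem IsPlanar.induce (h : D.IsPlanar) (S : Set V) : (D.induce S).IsPlanar := by
  refine Set.eq_empty_iff_forall_notMem.2 ?_
  rintro ⟨z, k⟩ ⟨e, f, he, hf, hne, -, h1, h2, h3⟩
  obtain ⟨h4, h5⟩ := h.eq_of_meet he hf h1 h2 h3
  exact hne (Prod.ext (Subtype.ext h4) (Subtype.ext h5))

theorem OnLeft.induce {S : Set V} {v : S} (h : D.OnLeft v) : (D.induce S).OnLeft v :=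
  fun a b hab hm => h a b hab hm

theorem OnRight.induce {S : Set V} {v : S} (h : D.OnRight v) : (D.induce S).OnRight v :=
  fun a b hab hm => h a b hab hm

theorem IsOuterplanarST.mirror {s t : V} (h : D.IsOuterplanarST s t) :
    D.mirror.IsOuterplanarST s t :=
  ⟨h.st, h.planar.mirror, fun v => (h.outer v).symm.imp mirror_onLeft.2 mirror_onRight.2⟩

theorem IsSTPolygon.mirror {s t : V} (h : D.IsSTPolygon s t) : D.mirror.IsSTPolygon s t where
  outerplanar := h.outerplanar.mirror
  left_vertex := h.right_vertex.imp fun _ hv => ⟨hv.1, hv.2.1, mirror_onLeft.2 hv.2.2⟩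
  right_vertex := h.left_vertex.imp fun _ hv => ⟨hv.1, hv.2.1, mirror_onRight.2 hv.2.2⟩
  sides_disjoint v h1 h2 h3 :=
    h.sides_disjoint v h1 h2 ⟨mirror_onRight.1 h3.2, mirror_onLeft.1 h3.1⟩
  no_two_sided u v h1 h2 h3 h4 h5 h6 :=
    (h.no_two_sided v u h3 h4 h1 h2 (mirror_onRight.1 h6) (mirror_onLeft.1 h5)).symm

theorem STPolygonOn.mirror {S : Set V} {a d : V} (h : D.STPolygonOn S a d) :
    D.mirror.STPolygonOn S a d := by
  obtain ⟨ha, hd, h⟩ := h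
  exact ⟨ha, hd, h.mirror⟩

theorem STPolygonOn.subset_pathInterval [Finite V] {S : Set V} {a d : V}
    (h : D.STPolygonOn S a d) : S ⊆ pathInterval G a d := by
  obtain ⟨ha, hd, h⟩ := h
  exact fun v hv => ⟨(h.outerplanar.st.path_from_source (D.induce S) ⟨v, hv⟩).of_induced,
    (h.outerplanar.st.path_to_sink (D.induce S) ⟨v, hv⟩).of_induced⟩

/-- If `u` were missing, an edge of the polygon would jump over it (`mem_or_exists_edge_around`),
which `no_edge_around` forbids. So a violation of separation in the path interval is already visible
in `S`. -/
theorem STPolygonOn.mem_of_edge [Finite V] {S : Set V} {a d s t : V} (h : D.STPolygonOn S a d)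
    (hG : D.IsOuterplanarST s t) {u w : V} (hu : D.OnLeft u) (hw : D.OnRight w)
    (hau : StrictlyBetween G a u d) (haw : StrictlyBetween G a w d)
    (huw : u = w ∨ G.Adj u w ∨ G.Adj w u) : u ∈ S := by
  have hT := hG.twoSided
  obtain ⟨ha, hd, h⟩ := h
  obtain ⟨p, hpa, hpd, hp⟩ := h.left_vertex
  have hZ : ∀ z : S, (D.induce S).OnLeft z ∧ z ≠ ⟨a, ha⟩ ∧ z ≠ ⟨d, hd⟩ →
      D.OnLeft z ∧ ¬ D.OnRight z := by
    rintro z ⟨h1, h2, h3⟩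
    have : ¬ D.OnRight z := fun hR => h.sides_disjoint z h2 h3 ⟨h1, OnRight.induce hR⟩
    exact ⟨(hG.outer z).resolve_right this, this⟩
  have hout := h.outerplanar.outer
  have hsucc : ∀ z w : S, ((D.induce S).OnLeft z ∧ z ≠ ⟨a, ha⟩ ∧ z ≠ ⟨d, hd⟩) → G.Adj z w →
      ((D.induce S).OnLeft w ∧ w ≠ ⟨a, ha⟩ ∧ w ≠ ⟨d, hd⟩) ∨ w = ⟨d, hd⟩ := by
    rintro z w ⟨h1, h2, h3⟩ hzw
    by_cases hwd : w = ⟨d, hd⟩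
    · exact .inr hwd
    have hwa : w ≠ ⟨a, ha⟩ := fun e => (h.outerplanar.st.source w).2 e z hzw
    exact .inl ⟨(hout w).resolve_right fun hR => (h.no_two_sided z w h2 h3 hwa hwd h1 hR).1 hzw,
      hwa, hwd⟩
  have hpred : ∀ z w : S, ((D.induce S).OnLeft w ∧ w ≠ ⟨a, ha⟩ ∧ w ≠ ⟨d, hd⟩) → G.Adj z w →
      ((D.induce S).OnLeft z ∧ z ≠ ⟨a, ha⟩ ∧ z ≠ ⟨d, hd⟩) ∨ z = ⟨a, ha⟩ := by
    rintro z w ⟨h1, h2, h3⟩ hzw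
    by_cases hza : z = ⟨a, ha⟩
    · exact .inr hza
    have hzd : z ≠ ⟨d, hd⟩ := fun e => (h.outerplanar.st.sink z).2 e w hzw
    exact .inl ⟨(hout z).resolve_right fun hR => (h.no_two_sided w z h2 h3 hza hzd h1 hR).2 hzw,
      hza, hzd⟩
  rcases mem_or_exists_edge_around hT.acyclic hT.chain_left (a := ⟨a, ha⟩) (d := ⟨d, hd⟩) (p := p)
    (fun z hz => (hZ z hz).1) ⟨hp, hpa, hpd⟩ hsucc hpred
    (h.outerplanar.st.path_from_source (D.induce S) p)
    (h.outerplanar.st.path_to_sink (D.induce S) p) hu hau with h1 | h1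
  · exact h1
  · obtain ⟨z, z', h2, h3, h4, h5, h6, h7, h8⟩ := h1
    exact (hT.no_edge_around hu hw haw huw h2 h3 h4 h5 h6
      (h7.imp (fun e => congrArg Subtype.val e) (hZ z))
      (h8.imp (fun e => congrArg Subtype.val e) (hZ z'))).elim

theorem mirror_onLeft_eq : D.mirror.OnLeft = D.OnRight := funext fun _ => propext mirror_onLeft

theorem mirror_onRight_eq : D.mirror.OnRight = D.OnLeft := funext fun _ => propext mirror_onRight

theorem STPolygonOn.isPolygonPair [Finite V] {S : Set V} {a d s t : V}
    (h : D.STPolygonOn S a d) (hG : D.IsOuterplanarST s t) :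
    IsPolygonPair G D.OnLeft D.OnRight a d := by
  have hS := h.subset_pathInterval
  obtain ⟨ha, hd, hP⟩ := id h
  refine ⟨?_, ?_, fun u w hu hw hau haw => ?_⟩
  · obtain ⟨p, h1, h2, h3⟩ := hP.left_vertex
    exact ⟨p, (hG.outer p).resolve_right fun hR => hP.sides_disjoint p h1 h2 ⟨h3, hR.induce⟩,
      (hS p.2).1, (hS p.2).2, fun e => h1 (Subtype.ext e), fun e => h2 (Subtype.ext e)⟩
  · obtain ⟨p, h1, h2, h3⟩ := hP.right_vertex
    exact ⟨p, (hG.outer p).resolve_left fun hL => hP.sides_disjoint p h1 h2 ⟨hL.induce, h3⟩,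
      (hS p.2).1, (hS p.2).2, fun e => h1 (Subtype.ext e), fun e => h2 (Subtype.ext e)⟩
  have key : ¬ (u = w ∨ G.Adj u w ∨ G.Adj w u) := by
    intro hcase
    have huS := h.mem_of_edge hG hu hw hau haw hcase
    have hwS := h.mirror.mem_of_edge hG.mirror (mirror_onLeft.2 hw) (mirror_onRight.2 hu) haw hau
      (by tauto)
    have hne : ∀ {v b : V} (hv : v ∈ S) (hb : b ∈ S), v ≠ b → (⟨v, hv⟩ : S) ≠ ⟨b, hb⟩ :=
      fun _ _ h e => h (congrArg Subtype.val e)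
    have hu1 := hne huS ha hau.2.2.1
    have hu2 := hne huS hd hau.2.2.2
    rcases hcase with rfl | hcase
    · exact hP.sides_disjoint ⟨u, huS⟩ hu1 hu2 ⟨OnLeft.induce hu, OnRight.induce hw⟩
    · have := hP.no_two_sided ⟨u, huS⟩ ⟨w, hwS⟩ hu1 hu2 (hne hwS ha haw.2.2.1)
        (hne hwS hd haw.2.2.2) (OnLeft.induce hu) (OnRight.induce hw)
      exact hcase.elim this.1 this.2
  tauto

/-- The main point is that the sides of the induced drawing share no inner vertex: such a vertex
would be comparable with an inner vertex of the opposite side of `G`, which gives a path across the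
polygon. -/
theorem _root_.IsPolygonPair.stPolygonOn [Finite V] {a d s t : V}
    (hp : IsPolygonPair G D.OnLeft D.OnRight a d) (hG : D.IsOuterplanarST s t) :
    D.STPolygonOn (pathInterval G a d) a d := by
  have hT := hG.twoSided
  have hac := hT.acyclic
  obtain ⟨u, hu, hau, hud, hua, hud'⟩ := hp.left
  obtain ⟨w, hw, haw, hwd, hwa, hwd'⟩ := hp.right
  have had : DirectedPath G a d := hau.trans hud
  have ha : a ∈ pathInterval G a d := ⟨.refl G a, had⟩
  have hd : d ∈ pathInterval G a d := ⟨had, .refl G d⟩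
  have hne : ∀ {v b : pathInterval G a d}, v ≠ b → (v : V) ≠ b := fun h e => h (Subtype.ext e)
  have hne' : ∀ {v b : V} (hv : v ∈ pathInterval G a d) (hb : b ∈ pathInterval G a d), v ≠ b →
      (⟨v, hv⟩ : pathInterval G a d) ≠ ⟨b, hb⟩ := fun _ _ h e => h (congrArg Subtype.val e)
  have hst : IsSTDigraph (inducedDigraph G (pathInterval G a d)) ⟨a, ha⟩ ⟨d, hd⟩ := by
    refine ⟨(D.induce _).acyclicDigraph, fun v => ⟨fun h => ?_, ?_⟩, fun v => ⟨fun h => ?_, ?_⟩⟩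
    · by_contra e
      obtain ⟨z, h1, h2⟩ := v.2.1.exists_tail (hne e).symm
      exact h ⟨z, h1, (DirectedPath.single h2).trans v.2.2⟩ h2
    · rintro rfl z hz
      exact hac.not_adj_of_path z.2.1 hz
    · by_contra e
      obtain ⟨z, h1, h2⟩ := v.2.2.exists_head (hne e)
      exact h ⟨z, v.2.1.trans (.single h1), h2⟩ h1
    · rintro rfl z hz
      exact hac.not_adj_of_path z.2.2 hz
  have hpl := hG.planar.induce (pathInterval G a d)
  have hdisj : ∀ v : pathInterval G a d, v ≠ ⟨a, ha⟩ → v ≠ ⟨d, hd⟩ →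
      ¬ ((D.induce _).OnLeft v ∧ (D.induce _).OnRight v) := by
    rintro v h1 h2 ⟨hL, hR⟩
    rcases hG.outer v with hv | hv
    · rcases le_total (D.y v) (D.y w) with hle | hle
      · have := (hpl.path_of_onRight hst (v := ⟨w, haw, hwd⟩) hR (OnRight.induce hw) hle).of_induced
        exact hT.no_path_across hp hv hw v.2.1 (hne h1) this hwd hwd'
      · have := (hpl.path_of_onRight hst (u := ⟨w, haw, hwd⟩) (OnRight.induce hw) hR hle).of_induced
        exact hT.symm.no_path_across hp.symm hw hv haw hwa this v.2.2 (hne h2)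
    · rcases le_total (D.y v) (D.y u) with hle | hle
      · have := (hpl.path_of_onLeft hst (v := ⟨u, hau, hud⟩) hL (OnLeft.induce hu) hle).of_induced
        exact hT.symm.no_path_across hp.symm hv hu v.2.1 (hne h1) this hud hud'
      · have := (hpl.path_of_onLeft hst (u := ⟨u, hau, hud⟩) (OnLeft.induce hu) hL hle).of_induced
        exact hT.no_path_across hp hu hv hau hua this v.2.2 (hne h2)
  refine ⟨ha, hd, ⟨hst, hpl, fun v => (hG.outer v).imp OnLeft.induce OnRight.induce⟩,
    ⟨⟨u, hau, hud⟩, hne' _ ha hua, hne' _ hd hud', OnLeft.induce hu⟩,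
    ⟨⟨w, haw, hwd⟩, hne' _ ha hwa, hne' _ hd hwd', OnRight.induce hw⟩, hdisj, ?_⟩
  intro v z h1 h2 h3 h4 h5 h6
  have hv : D.OnLeft v := (hG.outer v).resolve_right fun hR => hdisj v h1 h2 ⟨h5, hR.induce⟩
  have hz : D.OnRight z := (hG.outer z).resolve_left fun hL => hdisj z h3 h4 ⟨hL.induce, h6⟩
  exact (hp.separated v z hv hz ⟨v.2.1, v.2.2, hne h1, hne h2⟩
    ⟨z.2.1, z.2.2, hne h3, hne h4⟩).2

/-- A polygon lies in the path interval of its source and sink, which is itself a polygon;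
maximality forces equality. -/
theorem IsOuterplanarST.isMaximalSTPolygon_iff [Finite V] {S : Set V} {a d s t : V}
    (hG : D.IsOuterplanarST s t) : D.IsMaximalSTPolygon S a d ↔
      S = pathInterval G a d ∧ IsMaximalPolygonPair G D.OnLeft D.OnRight a d := by
  constructor
  · rintro ⟨h1, h2⟩
    have h3 : S = pathInterval G a d := by
      by_contra hne
      exact h2 _ a d ((h1.isPolygonPair hG).stPolygonOn hG)
        (lt_of_le_of_ne h1.subset_pathInterval hne)
    exact ⟨h3, h1.isPolygonPair hG, fun a' d' hp hss => h2 _ a' d' (hp.stPolygonOn hG) (h3 ▸ hss)⟩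
  · rintro ⟨rfl, h1, h2⟩
    exact ⟨h1.stPolygonOn hG, fun S' a' d' h3 h4 => h2 a' d' (h3.isPolygonPair hG)
      (h4.trans_le h3.subset_pathInterval)⟩

/-! ## Upper limiting edges -/

theorem STPolygonOn.isLimitingEdge [Finite V] {a d x s t : V}
    (h : D.STPolygonOn (pathInterval G a d) a d) (hG : D.IsOuterplanarST s t)
    (hx : x ∈ pathInterval G a d) (hd : d ∈ pathInterval G a d)
    (he : (D.induce (pathInterval G a d)).EdgeOnLeft ⟨x, hx⟩ ⟨d, hd⟩ ∨
      (D.induce (pathInterval G a d)).EdgeOnRight ⟨x, hx⟩ ⟨d, hd⟩)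
    (hxL : D.OnLeft x) (hdR : D.OnRight d) : IsLimitingEdge G D.OnLeft D.OnRight a d x := by
  have hp := h.isPolygonPair hG
  have hadj : G.Adj x d := he.elim (fun e => e.1) fun e => e.1
  have hxd := D.acyclicDigraph.ne_of_adj hadj
  rcases he with he | he
  · have hlast : ∀ l, D.OnLeft l → DirectedPath G x l → DirectedPath G l d → l = x ∨ l = d := by
      intro l hl hxl hld
      by_contra hcon
      obtain ⟨h1, h2⟩ := not_or.1 hcon
      obtain ⟨z, hxz, hzl⟩ := hxl.exists_tail (Ne.symm h1)
      have hy : D.y l ∈ Icc (D.y x) (D.y d) := ⟨D.y_le_of_path hxl, D.y_le_of_path hld⟩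
      -- A left vertex `l` strictly between `x` and `d` would be to the left of `(x, d)`, but the
      -- edge of a path entering `l` is not.
      have h3 : D.curve x d (D.y l) ≤ D.curve z l (D.y l) :=
        he.2 ⟨z, hx.1.trans hxz, (DirectedPath.single hzl).trans hld⟩ ⟨l, hx.1.trans hxl, hld⟩ hzl
          (D.y l) hy (D.right_mem hzl)
      rw [D.curve_end z l hzl] at h3
      exact (hl.lt_curve hadj h1 h2 hy).not_ge h3
    have hxa : x ≠ a := by
      rintro rfl
      obtain ⟨u, hu, h1, h2, h3, h4⟩ := hp.left
      exact (hlast u hu h1 h2).elim h3 h4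
    exact ⟨hadj, hxL, hdR, fun hR => (hp.separated x x hxL hR ⟨hx.1, hx.2, hxa, hxd⟩
      ⟨hx.1, hx.2, hxa, hxd⟩).1 rfl, hx.1, hxa, hlast⟩
  -- On the right boundary, the edge would leave no room for the right vertices if `x = a`, and
  -- would put `x` on both sides of the polygon otherwise.
  · exfalso
    by_cases hxa : x = a
    · subst hxa
      obtain ⟨w, hw, h1, h2, h3, h4⟩ := hp.right
      obtain ⟨z, hxz, hzw⟩ := h1.exists_tail h3.symm
      have hy : D.y w ∈ Icc (D.y x) (D.y d) := ⟨D.y_le_of_path h1, D.y_le_of_path h2⟩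
      have h5 : D.curve z w (D.y w) ≤ D.curve x d (D.y w) :=
        he.2 ⟨z, hxz, (DirectedPath.single hzw).trans h2⟩ ⟨w, h1, h2⟩ hzw (D.y w) hy
          (D.right_mem hzw)
      rw [D.curve_end z w hzw] at h5
      exact (hw.curve_lt hadj h3 h4 hy).not_ge h5
    · obtain ⟨ha, hd', hP⟩ := h
      refine hP.sides_disjoint ⟨x, hx⟩ (fun e => hxa (congrArg Subtype.val e))
        (fun e => hxd (congrArg Subtype.val e)) ⟨OnLeft.induce hxL, fun p q hpq hm => ?_⟩
      exact (he.2 p q hpq _ (D.left_mem hadj) hm).trans (D.curve_start x d hadj).le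

theorem IsOuterplanarST.isLimitingEdge [Finite V] {S : Set V} {a d x s t : V}
    (hG : D.IsOuterplanarST s t) (hS : D.IsMaximalSTPolygon S a d)
    (he : D.IsUpperLimitingEdge S x d) :
    IsLimitingEdge G D.OnLeft D.OnRight a d x ∨ IsLimitingEdge G D.OnRight D.OnLeft a d x := by
  obtain ⟨rfl, -⟩ := hG.isMaximalSTPolygon_iff.1 hS
  obtain ⟨⟨hx, hd, he⟩, ⟨h1, h2⟩ | ⟨h1, h2⟩⟩ := he
  · exact .inl (hS.1.isLimitingEdge hG hx hd he h1 h2)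
  · right
    have := hS.1.mirror.isLimitingEdge hG.mirror hx hd (he.symm.imp
      (fun e => ⟨e.1, fun p q hpq k h3 h4 => neg_le_neg (e.2 p q hpq k h3 h4)⟩)
      (fun e => ⟨e.1, fun p q hpq k h3 h4 => neg_le_neg (e.2 p q hpq k h3 h4)⟩))
      (mirror_onLeft.2 h1) (mirror_onRight.2 h2)
    rwa [mirror_onLeft_eq, mirror_onRight_eq] at this

/-- Vertices are ranked by height, with ties broken by abscissa. -/
theorem exists_linExt [Finite V] (D : UpwardDrawing G) : ∃ σ, LinExt G σ := by
  have hlt : ∀ {u v : V}, toLex (D.y u, D.x u) < toLex (D.y v, D.x v) →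
      {w | toLex (D.y w, D.x w) < toLex (D.y u, D.x u)}.ncard <
        {w | toLex (D.y w, D.x w) < toLex (D.y v, D.x v)}.ncard := fun {u v} huv =>
    Set.ncard_lt_ncard ((Set.ssubset_iff_of_subset fun w hw => lt_trans hw huv).2
      ⟨u, huv, lt_irrefl (toLex (D.y u, D.x u))⟩) (Set.toFinite _)
  refine ⟨fun v => {w | toLex (D.y w, D.x w) < toLex (D.y v, D.x v)}.ncard, fun u v huv => ?_,
    fun u v huv => hlt (Prod.Lex.toLex_lt_toLex.2 (.inl (D.upward u v huv))), fun v => ?_⟩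
  · rcases lt_trichotomy (toLex (D.y u, D.x u)) (toLex (D.y v, D.x v)) with h | h | h
    · exact absurd huv (hlt h).ne
    · obtain ⟨h1, h2⟩ := Prod.mk.inj (toLex.injective h)
      exact D.distinct (Prod.ext h2 h1)
    · exact absurd huv (hlt h).ne'
  · rw [← Set.ncard_univ]
    exact Set.ncard_lt_ncard ((Set.ssubset_iff_of_subset (Set.subset_univ _)).2
      ⟨v, Set.mem_univ v, lt_irrefl (toLex (D.y v, D.x v))⟩) (Set.toFinite _)

end UpwardDrawing

/-- The edges which cross an upper limiting edge enter the subgraph up to its polygon. -/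
theorem UpwardDrawing.crossing_enters {V : Type*} [Finite V] {G : Digraph V}
    {D : UpwardDrawing G} {L R : V → Prop} {σ : V → ℕ} {s : V} (h : TwoSided G L R)
    (ho : OptimalLinExt G L R σ) (hs : ∀ v, DirectedPath G s v)
    (hmax : ∀ S a d, D.IsMaximalSTPolygon S a d ↔
      S = pathInterval G a d ∧ IsMaximalPolygonPair G L R a d) {a d x : V}
    (hp : IsMaximalPolygonPair G L R a d) (he : IsLimitingEdge G L R a d x) {e : V × V}
    (hes : e ∈ switchesAround L R σ x d) :
    e.1 ∉ D.upToElement a ∧ e.2 ∈ D.upToElement a := by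
  have hσ := ho.linExt
  obtain ⟨hL, hR⟩ := h.no_switch_down ho hp.1 he hes
  obtain ⟨⟨h1, -⟩, h2, h3⟩ := hes
  have hax := hσ.le he.path
  constructor
  · rintro ⟨o, r, (⟨d', ho⟩ | ⟨-, rfl⟩), hra, hmem⟩
    · obtain ⟨rfl, hq⟩ := (hmax o r d').1 ho
      exact h.not_mem_lower_polygon hp he hL (h.path_of_left hσ he.left hL h2.le) (hσ.ne h2).symm
        (hσ.ne (by omega)) hq.1 hra hmem
    · obtain rfl : e.1 = r := hmem
      have := hσ.le hra
      omega
  · obtain ⟨c, c', hc, hca, hcr, hrc⟩ := h.exists_lower_polygon hσ hs hp.1 hR (by omega)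
      (h.path_of_right hσ hR he.right h3.le) (hσ.ne h3)
    -- Enlarging the polygon to a maximal one only moves its source to an ancestor, so it still
    -- precedes the polygon with source `a`.
    obtain ⟨b, b', hb, hsub⟩ := hc.exists_maximal
    have hcc' := hcr.trans hrc
    exact ⟨_, b, .inl ⟨b', (hmax _ b b').2 ⟨rfl, hb⟩⟩,
      (hsub ⟨.refl G c, hcc'⟩).1.trans hca, hsub ⟨hcr, hrc⟩⟩

/-! ### The main theorem -/

theorem mainTheorem5 {V : Type*} [Finite V] (G : Digraph V) (D : UpwardDrawing G) (s t : V)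
    (hG : D.IsOuterplanarST s t) :
    ∃ (P : Set (V × V)) (D' : UpwardDrawing (G ⊔ edgesDigraph P)),
      D.IsCrossingOptimal s t P D' ∧
      (∀ u v, G.Adj u v → {e ∈ P | D'.EdgesCross e (u, v)}.encard ≤ 2) ∧
      (∀ (S : Set V) (a d x : V), D.IsMaximalSTPolygon S a d → D.IsUpperLimitingEdge S x d →
        {e ∈ P | D'.EdgesCross e (x, d)}.encard ≤ 1 ∧
        ∀ e ∈ P, D'.EdgesCross e (x, d) → e.1 ∉ D.upToElement a ∧ e.2 ∈ D.upToElement a) := by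
  have h := hG.twoSided
  obtain ⟨τ, hτ⟩ := D.exists_linExt
  obtain ⟨σ, ho⟩ := exists_optimalLinExt D.OnLeft D.OnRight hτ
  have hσ := ho.linExt
  have hs := hG.st.path_from_source D
  have hcross : ∀ u v, G.Adj u v → ∀ e ∈ newEdges G σ,
      (UpwardDrawing.lens hσ.sup_newEdges D.OnLeft).EdgesCross e (u, v) →
      e ∈ switchesAround D.OnLeft D.OnRight σ u v := by
    rintro u v huv ⟨p, q⟩ he ⟨k, hk⟩
    exact UpwardDrawing.mem_switchesAround_of_meet h hσ hσ.sup_newEdges le_sup_left (.inr he) he.1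
      he.2 huv hk
  refine ⟨newEdges G σ, UpwardDrawing.lens hσ.sup_newEdges D.OnLeft,
    ⟨hσ.isAcyclicHPCompletion hs (hG.st.path_to_sink D),
      ⟨UpwardDrawing.lens_restrict_isPlanar h hσ hσ.sup_newEdges le_sup_left,
        UpwardDrawing.lens_sameEmbedding hG hσ hσ.sup_newEdges le_sup_left⟩, ?_⟩, ?_, ?_⟩
  · intro Q D'' hQ hD''
    obtain ⟨ρ, hρ, hle⟩ := UpwardDrawing.exists_linExt_forcedCrossings_le hG D'' hQ hD''
    refine (h.encard_lens_crossings_le hσ).trans (le_trans ?_ hle)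
    rw [← (Set.toFinite (forcedCrossings G _ _ σ)).cast_ncard_eq,
      ← (Set.toFinite (forcedCrossings G _ _ ρ)).cast_ncard_eq]
    exact_mod_cast ho.crossings_le ρ hρ
  · intro u v huv
    exact (Set.encard_le_encard fun e he => hcross u v huv e he.1 he.2).trans
      (h.encard_switchesAround_le ho huv)
  · intro S a d x hS he
    have hp := (hG.isMaximalSTPolygon_iff.1 hS).2
    have hadj : G.Adj x d := by
      obtain ⟨⟨_, _, he | he⟩, -⟩ := he
      exacts [he.1, he.1]
    have hsymm : switchesAround D.OnRight D.OnLeft σ x d = switchesAround D.OnLeft D.OnRight σ x d := by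
      unfold switchesAround
      rw [switchPairs_symm]
    have hsub : {e ∈ newEdges G σ | (UpwardDrawing.lens hσ.sup_newEdges D.OnLeft).EdgesCross e
        (x, d)} ⊆ switchesAround D.OnLeft D.OnRight σ x d :=
      fun e he => hcross x d hadj e he.1 he.2
    rcases hG.isLimitingEdge hS he with hl | hl
    · exact ⟨(Set.encard_le_encard hsub).trans (h.encard_switchesAround_le_one ho hp.1 hl),
        fun e he hc => UpwardDrawing.crossing_enters h ho hs
          (fun S a d => hG.isMaximalSTPolygon_iff) hp hl (hsub ⟨he, hc⟩)⟩
    -- The limiting edge from right to left is the mirror case; forced crossings and switches do not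
    -- change when the sides are exchanged.
    · rw [← hsymm] at hsub
      refine ⟨(Set.encard_le_encard hsub).trans
        (h.symm.encard_switchesAround_le_one ho.symm hp.1.symm hl), fun e he hc =>
          UpwardDrawing.crossing_enters h.symm ho.symm hs (fun S a d => ?_) hp.symm hl
            (hsub ⟨he, hc⟩)⟩
      exact hG.isMaximalSTPolygon_iff.trans (and_congr_right fun _ => ⟨fun e => e.symm,
        fun e => e.symm⟩)
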